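/- Let $M$ be a smooth ($C^\infty$, Hausdorff) $2$-manifold without boundary, and let $d\sigma^2=\langle\ ,\ \rangle$ be a smooth positive semi-definite metric on $M$. A point $p$ is *singular* if $d\sigma^2$ is not positive definite at $p$; $\Sigma$ denotes the set of singular points, and $\mathcal N_p=\{v\in T_pM:\ \langle v,w\rangle=0\ \text{for all } w\in T_pM\}$. For smooth vector fields put $$\Gamma(X,Y,Z)=\tfrac12\bigl(X\langle Y,Z\rangle+Y\langle X,Z\rangle-Z\langle X,Y\rangle+\langle[X,Y],Z\rangle-\langle[X,Z],Y\rangle-\langle[Y,Z],X\rangle\bigr).$$ A singular point $p$ is *admissible* if $\Gamma(X,Y,Z)(p)=0$ for all smooth vector fields $X,Y,Z$ with $Z_p\in\mathcal N_p$. In local coordinates $(u,v)$ write $d\sigma^2=E\,du^2+2F\,du\,dv+G\,dv^2$. The metric is a *Kossowski metric* if all singular points are admissible, in every local coordinate system $EG-F^2$ is, near each point, of the form $\lambda^2$ with $\lambda$ smooth, and $d\lambda\neq0$ at every singular point. It is *co-orientable* if there is a smooth $2$-form $d\hat A$ on $M$ such that, in every local coordinate system, $d\hat A=\lambda\,du\wedge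 dv$ with $\lambda^2=EG-F^2$. A *coherent tangent bundle* $\psi:TM\to(\mathcal E,\langle\ ,\ \rangle,D)$ consists of a smooth real vector bundle $\mathcal E$ over $M$ of rank $2$ with a smooth fibre metric, a smooth metric connection $D$, and a smooth bundle homomorphism $\psi$ such that $D_X\psi(Y)-D_Y\psi(X)=\psi([X,Y])$ for all smooth vector fields $X,Y$; its *first fundamental form* is $\psi^*\langle\ ,\ \rangle$. The bundle $\mathcal E$ is *orientable* if there is a smooth skew-symmetric bilinear section $\mu$ of $\mathcal E^*\wedge\mathcal E^*$ with $\mu(e_1,e_2)=\pm1$ for every orthonormal frame $\{e_1,e_2\}$. **Theorem.** Let $d\sigma^2$ be a Kossowski metric on $M$. Then there exists a coherent tangent bundle $\psi:TM\to(\mathcal E,\langle\ ,\ \rangle,D)$ whose first fundamental form is $d\sigma^2$, with the following properties. 1. Consider the local coordinate systems $\alpha=(U_\alpha;u_\alpha,v_\alpha)$ with $E_\alpha>0$ on $U_\alpha$, together with a smooth function $\lambda_\alpha$ on $U_\alpha$ such that $E_\alpha G_\alpha-F_\alpha^2=\lambda_\alpha^2$ (these cover $M$), and the orthonormal frames of $TM$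 on $U_\alpha\setminus\Sigma$ $$(e^\alpha_1,e^\alpha_2)=(\partial_{u_\alpha},\partial_{v_\alpha})\,\mathcal T_\alpha,\qquad \mathcal T_\alpha=\begin{pmatrix}1/\sqrt{E_\alpha}&-F_\alpha/(\lambda_\alpha\sqrt{E_\alpha})\\0&\sqrt{E_\alpha}/\lambda_\alpha\end{pmatrix}.$$ For each $\alpha$ there is a smooth orthonormal frame $(\hat e^\alpha_1,\hat e^\alpha_2)$ of $\mathcal E$ on $U_\alpha$ with $\psi(e^\alpha_i)=\hat e^\alpha_i$ off $\Sigma$. The transition matrices $\mathcal T_\alpha^{-1}\mathcal J_{\alpha\beta}\mathcal T_\beta$, where $\mathcal J_{\alpha\beta}=\partial(u_\alpha,v_\alpha)/\partial(u_\beta,v_\beta)$, which are defined on $(U_\alpha\cap U_\beta)\setminus\Sigma$, extend to smooth maps $g_{\alpha\beta}:U_\alpha\cap U_\beta\to \mathrm O(2)$, and $(\hat e^\beta_1,\hat e^\beta_2)=(\hat e^\alpha_1,\hat e^\alpha_2)\,g_{\alpha\beta}$ on $U_\alpha\cap U_\beta$. 2. On $M\setminus\Sigma$ the metric has a Levi-Civita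 connection $\nabla$, and $\psi(\nabla_XY)=D_X\psi(Y)$ there. The connection forms $\omega_\alpha=-\langle\nabla e^\alpha_1,e^\alpha_2\rangle$, which are defined on $U_\alpha\setminus\Sigma$, extend to smooth $1$-forms on $U_\alpha$, and $D\hat e^\alpha_1=-\omega_\alpha\hat e^\alpha_2$, $D\hat e^\alpha_2=\omega_\alpha\hat e^\alpha_1$ on $U_\alpha$. 3. If $d\sigma^2$ is co-orientable, then $\mathcal E$ is orientable. -/

import Mathlib

open Bundle Matrix
open scoped Manifold ContDiff Topology

noncomputable section

/-- The coordinate plane `ℝ²`. -/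
abbrev Plane : Type := EuclideanSpace ℝ (Fin 2)

section Metrics

variable (M : Type*) [TopologicalSpace M] [ChartedSpace Plane M] [IsManifold (𝓡 2) ∞ M]

/-- A smooth positive semi-definite metric `dσ²` on the surface `M`. -/
structure SemiMetric where
  /-- the bilinear form `⟨v, w⟩ = dσ²(v, w)` on each tangent space -/
  form (p : M) : TangentSpace (𝓡 2) p →L[ℝ] TangentSpace (𝓡 2) p →L[ℝ] ℝ
  symm (p : M) (v w : TangentSpace (𝓡 2) p) : form p v w = form p w v
  nonneg (p : M) (v : TangentSpace (𝓡 2) p) : 0 ≤ form p v v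
  contMDiff : ContMDiff (𝓡 2) ((𝓡 2).prod 𝓘(ℝ, Plane →L[ℝ] Plane →L[ℝ] ℝ)) ∞
    (fun p ↦ TotalSpace.mk' (Plane →L[ℝ] Plane →L[ℝ] ℝ) p (form p))

variable {M}

/-- `X` is a smooth vector field on `M`. -/
def IsSmoothField (X : ∀ p : M, TangentSpace (𝓡 2) p) : Prop :=
  ContMDiff (𝓡 2) ((𝓡 2).prod (𝓡 2)) ∞ (fun p ↦ TotalSpace.mk' Plane p (X p))

/-- The vector field `X` is differentiable at `p`. -/
def FieldDifferentiableAt (X : ∀ p : M, TangentSpace (𝓡 2) p) (p : M) : Prop :=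
  MDifferentiableAt (𝓡 2) ((𝓡 2).prod (𝓡 2)) (fun q ↦ TotalSpace.mk' Plane q (X q)) p

/-- The coordinate vector field `∂ᵢ` of the local coordinate system `e`, on its domain
`e.source`: the vector whose image under the differential of `e` is the `i`-th basis vector.
With coordinates `(u, v)`, `coordField e 0 = ∂_u` and `coordField e 1 = ∂_v`. -/
def coordField (e : OpenPartialHomeomorph M Plane) (i : Fin 2) (p : M) : TangentSpace (𝓡 2) p :=
  (mvfderiv (𝓡 2) e p).inverse (EuclideanSpace.single i (1 : ℝ))

namespace SemiMetric

variable (g : SemiMetric M)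

/-- A singular point: the metric is not positive definite at `p`. -/
def IsSingular (p : M) : Prop := ¬ ∀ v : TangentSpace (𝓡 2) p, v ≠ 0 → 0 < g.form p v v

/-- The singular set `Σ`. -/
def singularSet : Set M := {p | g.IsSingular p}

/-- Membership in the null space (radical) `N_p`. -/
def IsNull (p : M) (v : TangentSpace (𝓡 2) p) : Prop := ∀ w, g.form p v w = 0

/-- The Kossowski pseudo-connection `Γ(X, Y, Z)`, given by the Koszul formula. -/
def pseudoConnection (X Y Z : ∀ p : M, TangentSpace (𝓡 2) p) (p : M) : ℝ :=
  (1 / 2) *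
    (mvfderiv (𝓡 2) (fun q ↦ g.form q (Y q) (Z q)) p (X p)
      + mvfderiv (𝓡 2) (fun q ↦ g.form q (X q) (Z q)) p (Y p)
      - mvfderiv (𝓡 2) (fun q ↦ g.form q (X q) (Y q)) p (Z p)
      + g.form p (VectorField.mlieBracket (𝓡 2) X Y p) (Z p)
      - g.form p (VectorField.mlieBracket (𝓡 2) X Z p) (Y p)
      - g.form p (VectorField.mlieBracket (𝓡 2) Y Z p) (X p))

/-- The (singular) point `p` is admissible: the trilinear map
`T_pM × T_pM × N_p → ℝ` induced by `Γ` vanishes. -/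
def IsAdmissibleAt (p : M) : Prop :=
  ∀ X Y Z : ∀ q : M, TangentSpace (𝓡 2) q,
    IsSmoothField X → IsSmoothField Y → IsSmoothField Z → g.IsNull p (Z p) →
      g.pseudoConnection X Y Z p = 0

/-- The coefficient `E = ⟨∂_u, ∂_u⟩` in the local coordinate system `e = (u, v)`. -/
def coeffE (e : OpenPartialHomeomorph M Plane) (p : M) : ℝ :=
  g.form p (coordField e 0 p) (coordField e 0 p)

/-- The coefficient `F = ⟨∂_u, ∂_v⟩` in the local coordinate system `e = (u, v)`. -/
def coeffF (e : OpenPartialHomeomorph M Plane) (p : M) : ℝ :=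
  g.form p (coordField e 0 p) (coordField e 1 p)

/-- The coefficient `G = ⟨∂_v, ∂_v⟩` in the local coordinate system `e = (u, v)`. -/
def coeffG (e : OpenPartialHomeomorph M Plane) (p : M) : ℝ :=
  g.form p (coordField e 1 p) (coordField e 1 p)

/-- `lam` is a smooth function on `U` with `E G - F² = lam²`, with respect to the local
coordinate system `e`. -/
def IsAreaDensityOn (e : OpenPartialHomeomorph M Plane) (lam : M → ℝ) (U : Set M) : Prop :=
  ContMDiffOn (𝓡 2) 𝓘(ℝ) ∞ lam U ∧
    ∀ p ∈ U, g.coeffE e p * g.coeffG e p - g.coeffF e p ^ 2 = lam p ^ 2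

/-- A frontal metric: an admissible metric such that, in every local coordinate system,
`E G - F²` is (near each point) the square of a smooth function. -/
def IsFrontal : Prop :=
  (∀ p, g.IsSingular p → g.IsAdmissibleAt p) ∧
    ∀ e ∈ IsManifold.maximalAtlas (𝓡 2) ∞ M, ∀ p ∈ e.source,
      ∃ U : Set M, IsOpen U ∧ p ∈ U ∧ U ⊆ e.source ∧ ∃ lam : M → ℝ, g.IsAreaDensityOn e lam U

/-- `p` is non-degenerate: `d lam ≠ 0` at `p`, for the functions `lam` with `E G - F² = lam²`
near `p`. -/
def IsNondegenerateAt (p : M) : Prop :=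
  ∀ e ∈ IsManifold.maximalAtlas (𝓡 2) ∞ M, ∀ U : Set M, IsOpen U → p ∈ U → U ⊆ e.source →
    ∀ lam : M → ℝ, g.IsAreaDensityOn e lam U → mvfderiv (𝓡 2) lam p ≠ 0

/-- A Kossowski metric: a frontal metric all of whose singular points are non-degenerate. -/
def IsKossowski : Prop :=
  g.IsFrontal ∧ ∀ p, g.IsSingular p → g.IsNondegenerateAt p

/-- Co-orientability: there is a smooth `2`-form `dA` on `M` (the signed area element) whose
coefficient `lam = dA(∂_u, ∂_v)` satisfies `E G - F² = lam²` in every local coordinate system. -/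
def IsCoorientable : Prop :=
  ∃ dA : ∀ p : M, TangentSpace (𝓡 2) p →L[ℝ] TangentSpace (𝓡 2) p →L[ℝ] ℝ,
    ContMDiff (𝓡 2) ((𝓡 2).prod 𝓘(ℝ, Plane →L[ℝ] Plane →L[ℝ] ℝ)) ∞
      (fun p ↦ TotalSpace.mk' (Plane →L[ℝ] Plane →L[ℝ] ℝ) p (dA p)) ∧
    (∀ p v, dA p v v = 0) ∧
    ∀ e ∈ IsManifold.maximalAtlas (𝓡 2) ∞ M, ∀ p ∈ e.source,
      g.coeffE e p * g.coeffG e p - g.coeffF e p ^ 2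
        = dA p (coordField e 0 p) (coordField e 1 p) ^ 2

/-- `nabla` is the Levi-Civita connection of `g` on `U` (a set on which `g` is positive definite):
a metric and torsion-free covariant derivative. Here `nabla Y p v` is `∇_v Y` at `p`. -/
structure IsLeviCivitaOn
    (nabla : (∀ p : M, TangentSpace (𝓡 2) p) →
      ∀ p : M, TangentSpace (𝓡 2) p →L[ℝ] TangentSpace (𝓡 2) p)
    (U : Set M) : Prop where
  isCovariantDerivativeOn : IsCovariantDerivativeOn Plane nabla U
  metric {Y Z : ∀ p : M, TangentSpace (𝓡 2) p} {p : M} (hp : p ∈ U)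
    (hY : FieldDifferentiableAt Y p) (hZ : FieldDifferentiableAt Z p)
    (v : TangentSpace (𝓡 2) p) :
    mvfderiv (𝓡 2) (fun q ↦ g.form q (Y q) (Z q)) p v
      = g.form p (nabla Y p v) (Z p) + g.form p (Y p) (nabla Z p v)
  torsion_free {X Y : ∀ p : M, TangentSpace (𝓡 2) p} {p : M} (hp : p ∈ U)
    (hX : FieldDifferentiableAt X p) (hY : FieldDifferentiableAt Y p) :
    nabla Y p (X p) - nabla X p (Y p) = VectorField.mlieBracket (𝓡 2) X Y p

/-- A local coordinate system `(u, v)` on which `E > 0`, with a smooth function `lam` such that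
`E G - F² = lam²` on it. For a Kossowski metric, singular points have rank one, so `E > 0` holds
in particular in every adapted coordinate system (`∂_v` null at the singular points). -/
structure FrameChart where
  /-- the coordinate system -/
  chart : OpenPartialHomeomorph M Plane
  mem_maximalAtlas : chart ∈ IsManifold.maximalAtlas (𝓡 2) ∞ M
  /-- the signed area density -/
  lam : M → ℝ
  isAreaDensityOn : g.IsAreaDensityOn chart lam chart.source
  coeffE_pos : ∀ p ∈ chart.source, 0 < g.coeffE chart p

namespace FrameChart

variable {g}

/-- The matrix `T` with `(e₁, e₂) = (∂_u, ∂_v) T`, where `e₁ = ∂_u / √E` and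
`e₂ = (-(F / √E) ∂_u + √E ∂_v) / lam`. -/
def frameMatrix (α : g.FrameChart) (p : M) : Matrix (Fin 2) (Fin 2) ℝ :=
  !![1 / √(g.coeffE α.chart p), -(g.coeffF α.chart p) / (α.lam p * √(g.coeffE α.chart p));
     0, √(g.coeffE α.chart p) / α.lam p]

/-- The orthonormal frame field `(e₁, e₂) = (∂_u, ∂_v) T` off the singular set. -/
def tangentFrame (α : g.FrameChart) (j : Fin 2) (p : M) : TangentSpace (𝓡 2) p :=
  ∑ i, α.frameMatrix p i j • coordField α.chart i p

/-- The Jacobian matrix `J_αβ` of the change of coordinates: its `j`-th column consists of the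
components of the `j`-th coordinate field of `β` in the coordinates of `α`. -/
def jacobian (α β : g.FrameChart) (p : M) : Matrix (Fin 2) (Fin 2) ℝ :=
  Matrix.of fun i j ↦ (mvfderiv (𝓡 2) α.chart p (coordField β.chart j p) : Plane) i

end FrameChart

end SemiMetric

end Metrics

section Bundles

/-- A coherent tangent bundle `ψ : TM → (𝓔, ⟨·,·⟩, D)` over the surface `M`: a smooth real vector
bundle of rank two with a smooth fibre metric, a smooth metric connection `D`, and a smooth bundle
homomorphism `ψ` with `D_X ψ(Y) - D_Y ψ(X) = ψ([X, Y])`. Here `conn s p v` is `D_v s` at `p`. -/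
structure CoherentTangentBundle (M : Type*) [TopologicalSpace M] [ChartedSpace Plane M]
    [IsManifold (𝓡 2) ∞ M] where
  /-- the fibre of `𝓔` at `p` -/
  fiber : M → Type
  [normedAddCommGroup : ∀ p, NormedAddCommGroup (fiber p)]
  [innerProductSpace : ∀ p, InnerProductSpace ℝ (fiber p)]
  [topologicalSpace : TopologicalSpace (TotalSpace Plane fiber)]
  [fiberBundle : FiberBundle Plane fiber]
  [vectorBundle : VectorBundle ℝ Plane fiber]
  [contMDiffVectorBundle : ContMDiffVectorBundle ∞ Plane fiber (𝓡 2)]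
  [riemannianBundle : IsContMDiffRiemannianBundle (𝓡 2) ∞ Plane fiber]
  /-- the connection `D` -/
  conn : CovariantDerivative (𝓡 2) Plane fiber
  contMDiff_conn : CovariantDerivative.ContMDiffCovariantDerivative conn ∞
  isMetric_conn : conn.IsMetricCompatible
  /-- the bundle homomorphism `ψ` -/
  hom (p : M) : TangentSpace (𝓡 2) p →L[ℝ] fiber p
  contMDiff_hom : ContMDiff (𝓡 2) ((𝓡 2).prod 𝓘(ℝ, Plane →L[ℝ] Plane)) ∞
    (fun p ↦ TotalSpace.mk' (Plane →L[ℝ] Plane)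
      (E := fun q ↦ TangentSpace (𝓡 2) q →L[ℝ] fiber q) p (hom p))
  coherent (X Y : ∀ p : M, TangentSpace (𝓡 2) p) (hX : IsSmoothField X) (hY : IsSmoothField Y)
    (p : M) :
    conn (fun q ↦ hom q (Y q)) p (X p) - conn (fun q ↦ hom q (X q)) p (Y p)
      = hom p (VectorField.mlieBracket (𝓡 2) X Y p)

namespace CoherentTangentBundle

attribute [instance] normedAddCommGroup innerProductSpace topologicalSpace fiberBundle
  vectorBundle contMDiffVectorBundle riemannianBundle

variable {M : Type*} [TopologicalSpace M] [ChartedSpace Plane M] [IsManifold (𝓡 2) ∞ M]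
variable (𝓔 : CoherentTangentBundle M)

/-- `g` is the first fundamental form `ψ^*⟨·,·⟩` of the coherent tangent bundle. -/
def IsFirstFundamentalForm (g : SemiMetric M) : Prop :=
  ∀ (p : M) (v w : TangentSpace (𝓡 2) p), g.form p v w = inner ℝ (𝓔.hom p v) (𝓔.hom p w)

/-- `𝓔` is orientable: there is a smooth skew-symmetric bilinear section `μ` with
`μ(e₁, e₂) = ±1` for every orthonormal frame (in particular `μ` does not vanish). -/
def IsOrientable : Prop :=
  ∃ μ : ∀ p : M, 𝓔.fiber p →L[ℝ] 𝓔.fiber p →L[ℝ] ℝ,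
    ContMDiff (𝓡 2) ((𝓡 2).prod 𝓘(ℝ, Plane →L[ℝ] Plane →L[ℝ] ℝ)) ∞
      (fun p ↦ TotalSpace.mk' (Plane →L[ℝ] Plane →L[ℝ] ℝ) p (μ p)) ∧
    (∀ p v, μ p v v = 0) ∧
    ∀ p (b : Fin 2 → 𝓔.fiber p), Orthonormal ℝ b → μ p (b 0) (b 1) = 1 ∨ μ p (b 0) (b 1) = -1

/-- Over the frame charts of `g`, the bundle `𝓔` is glued from the orthonormal frames of `TM` off
the singular set, and its connection extends the Levi-Civita connection:
* `frame α` is a smooth orthonormal frame of `𝓔` over the domain of `α`, which off the singular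
  set is the image under `ψ` of `(e₁, e₂) = (∂_u, ∂_v) T_α`;
* `trans α β` is a smooth `O(2)`-valued function on the overlap, which off the singular set is
  the transition matrix `T_α⁻¹ J_αβ T_β` of the frames of `TM`, and `frame β = frame α * trans α β`;
* off the singular set `ψ` carries the Levi-Civita connection `nabla` to `D`, and `θ α` is a smooth
  `1`-form on the domain of `α` which there is the connection form `-⟨∇ e₁, e₂⟩`, and
  `D ê₁ = -θ ê₂`, `D ê₂ = θ ê₁` for `(ê₁, ê₂) = frame α`. -/
structure IsGluedFromFrames (g : SemiMetric M)
    (frame : g.FrameChart → Fin 2 → ∀ p : M, 𝓔.fiber p)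
    (trans : g.FrameChart → g.FrameChart → M → Matrix (Fin 2) (Fin 2) ℝ)
    (nabla : (∀ p : M, TangentSpace (𝓡 2) p) →
      ∀ p : M, TangentSpace (𝓡 2) p →L[ℝ] TangentSpace (𝓡 2) p)
    (θ : g.FrameChart → ∀ p : M, TangentSpace (𝓡 2) p →L[ℝ] ℝ) : Prop where
  cover (p : M) : ∃ α : g.FrameChart, p ∈ α.chart.source
  contMDiffOn_frame (α : g.FrameChart) (i : Fin 2) :
    ContMDiffOn (𝓡 2) ((𝓡 2).prod 𝓘(ℝ, Plane)) ∞
      (fun p ↦ TotalSpace.mk' Plane p (frame α i p)) α.chart.source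
  orthonormal_frame (α : g.FrameChart) (p : M) (hp : p ∈ α.chart.source) :
    Orthonormal ℝ (fun i ↦ frame α i p)
  hom_tangentFrame (α : g.FrameChart) (p : M) (hp : p ∈ α.chart.source)
    (hp' : p ∉ g.singularSet) (i : Fin 2) : 𝓔.hom p (α.tangentFrame i p) = frame α i p
  contMDiffOn_trans (α β : g.FrameChart) (i j : Fin 2) :
    ContMDiffOn (𝓡 2) 𝓘(ℝ) ∞ (fun p ↦ trans α β p i j) (α.chart.source ∩ β.chart.source)
  trans_mem (α β : g.FrameChart) (p : M) (hp : p ∈ α.chart.source ∩ β.chart.source) :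
    trans α β p ∈ Matrix.orthogonalGroup (Fin 2) ℝ
  trans_eq (α β : g.FrameChart) (p : M) (hp : p ∈ α.chart.source ∩ β.chart.source)
    (hp' : p ∉ g.singularSet) :
    trans α β p = (α.frameMatrix p)⁻¹ * α.jacobian β p * β.frameMatrix p
  frame_eq (α β : g.FrameChart) (p : M) (hp : p ∈ α.chart.source ∩ β.chart.source) (j : Fin 2) :
    frame β j p = ∑ i, trans α β p i j • frame α i p
  isLeviCivitaOn : g.IsLeviCivitaOn nabla g.singularSetᶜ
  hom_nabla (Y : ∀ p : M, TangentSpace (𝓡 2) p) (p : M) (hp : p ∉ g.singularSet)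
    (hY : FieldDifferentiableAt Y p) (v : TangentSpace (𝓡 2) p) :
    𝓔.hom p (nabla Y p v) = 𝓔.conn (fun q ↦ 𝓔.hom q (Y q)) p v
  contMDiffOn_form (α : g.FrameChart) :
    ContMDiffOn (𝓡 2) ((𝓡 2).prod 𝓘(ℝ, Plane →L[ℝ] ℝ)) ∞
      (fun p ↦ TotalSpace.mk' (Plane →L[ℝ] ℝ) p (θ α p)) α.chart.source
  form_eq (α : g.FrameChart) (p : M) (hp : p ∈ α.chart.source) (hp' : p ∉ g.singularSet)
    (v : TangentSpace (𝓡 2) p) :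
    θ α p v = - g.form p (nabla (α.tangentFrame 0) p v) (α.tangentFrame 1 p)
  conn_frame_zero (α : g.FrameChart) (p : M) (hp : p ∈ α.chart.source)
    (v : TangentSpace (𝓡 2) p) : 𝓔.conn (frame α 0) p v = - θ α p v • frame α 1 p
  conn_frame_one (α : g.FrameChart) (p : M) (hp : p ∈ α.chart.source)
    (v : TangentSpace (𝓡 2) p) : 𝓔.conn (frame α 1) p v = θ α p v • frame α 0 p

end CoherentTangentBundle

end Bundles

end

/-!
Near a point where `∂u` is not a null vector, a positive semi-definite metric with
`EG - F² = λ²` has the smooth orthonormal coframe `η₀ = √E du + (F/√E) dv`, `η₁ = (λ/√E) dv`,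
which merely degenerates where `λ = 0`. The bundle `𝓔` is the one of which `(η₀, η₁)` are the
components of `ψ`.

*Gluing.* For two such charts `(α, λ_α)`, `(β, λ_β)` the functions `λ_α det J` and `λ_β` have the
same square, and since `dλ` does not vanish on the zeros of `λ`, they agree near each point up to
a constant sign (`eventually_eq_or_eq_neg_of_sq_eq_sq`). Hence the two coframes differ by a
matrix in `O(2)` that is smooth across the singular set
(`SemiMetric.FrameChart.coframe_eq_sum_trans`). These matrices are the cocycle of a vector bundle
with a fibre metric, and the coframes fit together to the bundle homomorphism `ψ`. The charts
cover `M`, because a Kossowski metric has rank at least one: where it vanishes, `E` and `G` have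
minima, so that `λ² ≤ EG` vanishes to fourth order and `dλ = 0`.

*Connection.* The connection form `θ` is determined off the singular set by the structure
equations `dη₀ = η₁ ∧ θ`, `dη₁ = θ ∧ η₀`. Solving them requires a division by `λ` of a function
which vanishes on the singular set by admissibility
(`SemiMetric.FrameChart.mvfderiv_coframeMatrix_eq`). A smooth function vanishing on the zeros of
`λ` is a smooth multiple of `λ` (`exists_contMDiffOn_eq_mul`), by Hadamard's lemma in a chart in
which `λ` is a coordinate. So each chart carries a smooth metric connection that is torsion-free
in the sense of a coherent tangent bundle. Such connections are unique off the singular set,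
where `ψ` is an isomorphism; the regular points are dense, so the local connections agree
(`SemiMetric.FrameFiber.localConn_eq`) and form one connection.

*Orientation.* A smooth 2-form `dA` with `dA(∂u, ∂v)² = EG - F²` differs from `λ` near each point
by a constant sign, and this sign is the value on the frame of `α` of the skew-symmetric form
sought (`SemiMetric.orientSign`).
-/

noncomputable section

/-! ### Division of smooth functions -/

section Division

universe u

/-- Differentiation under the integral sign, for a jointly smooth integrand. -/
lemma hasFDerivAt_intervalIntegral_of_contDiff {E F : Type u} [NormedAddCommGroup E]
    [NormedSpace ℝ E] [FiniteDimensional ℝ E] [NormedAddCommGroup F] [NormedSpace ℝ F]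
    {f : E × ℝ → F} (hf : ContDiff ℝ ∞ f) (x : E) :
    HasFDerivAt (fun x ↦ ∫ r in (0 : ℝ)..1, f (x, r))
      (∫ r in (0 : ℝ)..1, (fderiv ℝ f (x, r)).comp (ContinuousLinearMap.inl ℝ E ℝ)) x := by
  have : ProperSpace E := FiniteDimensional.proper ℝ E
  have hdf : Continuous (fun q : E × ℝ ↦
      (fderiv ℝ f q).comp (ContinuousLinearMap.inl ℝ E ℝ)) :=
    (hf.continuous_fderiv (by simp)).clm_comp continuous_const
  obtain ⟨C, hC⟩ := ((isCompact_closedBall x 1).prod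
    (isCompact_Icc (a := (0 : ℝ)) (b := 1))).exists_bound_of_continuousOn hdf.continuousOn
  have hslice : ∀ y : E, Continuous fun r : ℝ ↦ (y, r) := fun y ↦ by fun_prop
  refine intervalIntegral.hasFDerivAt_integral_of_dominated_of_fderiv_le
    (F' := fun y r ↦ (fderiv ℝ f (y, r)).comp (ContinuousLinearMap.inl ℝ E ℝ))
    (bound := fun _ ↦ C) (Metric.closedBall_mem_nhds x one_pos) ?_ ?_ ?_ ?_ ?_ ?_
  · exact .of_forall fun y ↦ (hf.continuous.comp (hslice y)).aestronglyMeasurable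
  · exact (hf.continuous.comp (hslice x)).intervalIntegrable _ _
  · exact (hdf.comp (hslice x)).aestronglyMeasurable
  · refine .of_forall fun r hr y hy ↦ hC (y, r) ⟨hy, ?_⟩
    rw [Set.uIoc_of_le zero_le_one] at hr
    exact ⟨hr.1.le, hr.2⟩
  · exact intervalIntegrable_const
  · refine .of_forall fun r _ y _ ↦ ?_
    have h1 : HasFDerivAt f (fderiv ℝ f (y, r)) (y, r) :=
      (hf.differentiable (by simp) _).hasFDerivAt
    exact h1.comp y (hasFDerivAt_prodMk_left y r)

/-- An integral over `[0, 1]` depends smoothly on a parameter if the integrand is jointly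
smooth. -/
lemma contDiff_intervalIntegral_param {E F : Type u} [NormedAddCommGroup E]
    [NormedSpace ℝ E] [FiniteDimensional ℝ E] [NormedAddCommGroup F] [NormedSpace ℝ F]
    {f : E × ℝ → F} (hf : ContDiff ℝ ∞ f) :
    ContDiff ℝ ∞ (fun x ↦ ∫ r in (0 : ℝ)..1, f (x, r)) := by
  rw [contDiff_infty]
  intro n
  induction n generalizing F with
  | zero =>
    exact contDiff_zero.2 (continuous_iff_continuousAt.2 fun x ↦
      (hasFDerivAt_intervalIntegral_of_contDiff hf x).continuousAt)
  | succ n ih =>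
    push_cast
    rw [contDiff_succ_iff_fderiv]
    refine ⟨fun x ↦ (hasFDerivAt_intervalIntegral_of_contDiff hf x).differentiableAt, by simp, ?_⟩
    have h : fderiv ℝ (fun x ↦ ∫ r in (0 : ℝ)..1, f (x, r)) = fun x ↦
        ∫ r in (0 : ℝ)..1, (fderiv ℝ f (x, r)).comp (ContinuousLinearMap.inl ℝ E ℝ) :=
      funext fun x ↦ (hasFDerivAt_intervalIntegral_of_contDiff hf x).fderiv
    rw [h]
    exact ih (f := fun q ↦ (fderiv ℝ f q).comp (ContinuousLinearMap.inl ℝ E ℝ))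
      ((hf.fderiv_right (by simp)).clm_comp contDiff_const)

/-- Hadamard's lemma: a smooth function which vanishes on a hyperplane is divisible by the
equation of the hyperplane. -/
lemma exists_contDiff_eq_mul_of_eq_zero_on_hyperplane {E : Type} [NormedAddCommGroup E]
    [NormedSpace ℝ E] [FiniteDimensional ℝ E] {f : E → ℝ} (hf : ContDiff ℝ ∞ f)
    (ℓ : E →L[ℝ] ℝ) {w : E} (hw : ℓ w = 1) (x₀ : E) (h : ∀ x, ℓ (x - x₀) = 0 → f x = 0) :
    ∃ k : E → ℝ, ContDiff ℝ ∞ k ∧ ∀ x, f x = ℓ (x - x₀) * k x := by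
  let φ : E × ℝ → E := fun q ↦ q.1 - ((1 - q.2) * ℓ (q.1 - x₀)) • w
  have hφ : ContDiff ℝ ∞ φ := by fun_prop
  refine ⟨fun x ↦ ∫ r in (0 : ℝ)..1, fderiv ℝ f (φ (x, r)) w,
    contDiff_intervalIntegral_param (f := fun q ↦ fderiv ℝ f (φ q) w)
      (((hf.fderiv_right (by simp)).comp hφ).clm_apply contDiff_const), fun x ↦ ?_⟩
  have hderiv (r : ℝ) : HasDerivAt (fun r ↦ f (φ (x, r)))
      (ℓ (x - x₀) * fderiv ℝ f (φ (x, r)) w) r := by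
    have h1 : HasDerivAt (fun r ↦ φ (x, r)) (ℓ (x - x₀) • w) r := by
      have h2 : HasDerivAt (fun r : ℝ ↦ (1 - r) * ℓ (x - x₀)) (-1 * ℓ (x - x₀)) r :=
        ((hasDerivAt_id r).const_sub 1).mul_const _
      convert! (h2.smul_const w).const_sub x using 1
      module
    have h3 := ((hf.differentiable (by simp) (φ (x, r))).hasFDerivAt).comp_hasDerivAt r h1
    convert! h3 using 1
    simp
  have key := intervalIntegral.integral_eq_sub_of_hasDerivAt (a := 0) (b := 1)
    (fun r _ ↦ hderiv r) (Continuous.intervalIntegrable (by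
      have := hf.continuous_fderiv (by simp)
      have := hφ.continuous
      fun_prop) _ _)
  rw [intervalIntegral.integral_const_mul] at key
  rw [key, show φ (x, 1) = x by simp [φ], h (φ (x, 0)) (by simp [φ, hw]), sub_zero]

/-- Local division: near a zero of `l` at which `dl ≠ 0`, a smooth function vanishing on the zero
set of `l` is a smooth multiple of `l`. -/
lemma exists_contDiffOn_eq_mul_nhds {E : Type} [NormedAddCommGroup E]
    [InnerProductSpace ℝ E] [FiniteDimensional ℝ E] {f l : E → ℝ} {U : Set E} (hU : IsOpen U)
    (hf : ContDiffOn ℝ ∞ f U) (hl : ContDiffOn ℝ ∞ l U) {x₀ : E} (hx₀ : x₀ ∈ U)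
    (hl₀ : l x₀ = 0) (hdl : fderiv ℝ l x₀ ≠ 0) (h : ∀ x ∈ U, l x = 0 → f x = 0) :
    ∃ V : Set E, IsOpen V ∧ x₀ ∈ V ∧ V ⊆ U ∧
      ∃ k : E → ℝ, ContDiffOn ℝ ∞ k V ∧ ∀ x ∈ V, f x = l x * k x := by
  set ℓ := fderiv ℝ l x₀ with hℓ
  obtain ⟨w, hw⟩ : ∃ w, ℓ w = 1 := by
    obtain ⟨v, hv⟩ := DFunLike.ne_iff.1 hdl
    exact ⟨(ℓ v)⁻¹ • v, by simpa using inv_mul_cancel₀ hv⟩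
  -- `Φ` is a local diffeomorphism which turns `l` into the linear function `ℓ (· - x₀)`
  let Φ : E → E := fun x ↦ x + (l x - ℓ (x - x₀)) • w
  have hΦ : ContDiffOn ℝ ∞ Φ U := by fun_prop
  have hℓΦ (x : E) : ℓ (Φ x - x₀) = l x := by simp [Φ, hw]; ring
  have hΦ₀ : Φ x₀ = x₀ := by simp [Φ, hl₀]
  have hΦat {x : E} (hx : x ∈ U) : ContDiffAt ℝ ∞ Φ x := hΦ.contDiffAt (hU.mem_nhds hx)
  have hd₀ : HasFDerivAt Φ (ContinuousLinearEquiv.refl ℝ E : E →L[ℝ] E) x₀ := by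
    have h1 : HasFDerivAt l ℓ x₀ :=
      ((hl.contDiffAt (hU.mem_nhds hx₀)).differentiableAt (by simp)).hasFDerivAt
    have h2 : HasFDerivAt (fun x ↦ ℓ (x - x₀)) ℓ x₀ :=
      ℓ.hasFDerivAt.comp x₀ ((hasFDerivAt_id x₀).sub_const x₀)
    convert! (hasFDerivAt_id x₀).add ((h1.sub h2).smul_const w) using 1
    ext v
    simp
  have hs₀ : HasStrictFDerivAt Φ (ContinuousLinearEquiv.refl ℝ E : E →L[ℝ] E) x₀ :=
    (hΦat hx₀).hasStrictFDerivAt' hd₀ (by simp)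
  let P := hs₀.toOpenPartialHomeomorph Φ
  have hPc : (P : E → E) = Φ := hs₀.toOpenPartialHomeomorph_coe
  have hPs : x₀ ∈ P.source := hs₀.mem_toOpenPartialHomeomorph_source
  obtain ⟨W, hWsub, hW, hx₀W⟩ : ∃ W ⊆ U ∩ P.source ∩ {x | ∃ e : E ≃L[ℝ] E,
      (e : E →L[ℝ] E) = fderiv ℝ Φ x}, IsOpen W ∧ x₀ ∈ W := by
    rw [← mem_nhds_iff]
    refine Filter.inter_mem (Filter.inter_mem (hU.mem_nhds hx₀) (P.open_source.mem_nhds hPs)) ?_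
    have hc : ContinuousAt (fderiv ℝ Φ) x₀ :=
      ((hΦat hx₀).fderiv_right (m := 0) (by simp)).continuousAt
    refine Filter.mem_map.1 (hc ?_ : Set.range ContinuousLinearEquiv.toContinuousLinearMap ∈ _)
    rw [hd₀.fderiv]
    exact ContinuousLinearEquiv.nhds _
  let N : Set E := P.target ∩ P.symm ⁻¹' W
  have hN : IsOpen N := P.isOpen_inter_preimage_symm hW
  have hx₀N : x₀ ∈ N := by
    have h1 := P.map_source hPs
    have h2 := P.left_inv hPs
    rw [hPc, hΦ₀] at h1 h2
    exact ⟨h1, by simpa [h2] using hx₀W⟩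
  have hsymm {y : E} (hy : y ∈ N) : ContDiffAt ℝ ∞ P.symm y := by
    obtain ⟨⟨hyU, -⟩, e, he⟩ := hWsub hy.2
    refine P.contDiffAt_symm (f₀' := e) hy.1 ?_ ?_
    · rw [hPc, he]
      exact ((hΦat hyU).differentiableAt (by simp)).hasFDerivAt
    · rw [hPc]
      exact hΦat hyU
  obtain ⟨r, hr, hrN⟩ := Metric.nhds_basis_closedBall.mem_iff.1 (hN.mem_nhds hx₀N)
  let χ : ContDiffBump x₀ := ⟨r / 2, r, by positivity, by linarith⟩
  have hχN : tsupport χ ⊆ N := χ.tsupport_eq ▸ hrN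
  let b : E → ℝ := fun y ↦ χ y * f (P.symm y)
  have hb : ContDiff ℝ ∞ b := by
    rw [contDiff_iff_contDiffAt]
    intro y
    by_cases hy : y ∈ tsupport χ
    · have hyU := (hWsub (hχN hy).2).1.1
      exact χ.contDiffAt.mul
        (((hf.contDiffAt (hU.mem_nhds hyU))).comp y (hsymm (hχN hy)))
    · refine (contDiffAt_const (c := (0 : ℝ))).congr_of_eventuallyEq ?_
      filter_upwards [(isClosed_tsupport χ).isOpen_compl.mem_nhds hy] with z hz
      simp [b, image_eq_zero_of_notMem_tsupport hz]
  obtain ⟨k, hk, hbk⟩ := exists_contDiff_eq_mul_of_eq_zero_on_hyperplane hb ℓ hw x₀ fun y hy ↦ by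
    by_cases hyN : y ∈ N
    · have h1 := P.right_inv hyN.1
      rw [hPc] at h1
      have h2 := hℓΦ (P.symm y)
      rw [h1, hy] at h2
      simp [b, h _ (hWsub hyN.2).1.1 h2.symm]
    · simp [b, image_eq_zero_of_notMem_tsupport (fun hy' ↦ hyN (hχN hy'))]
  have hWU : W ⊆ U := fun x hx ↦ (hWsub hx).1.1
  refine ⟨W ∩ Φ ⁻¹' Metric.ball x₀ (r / 2),
    (hΦ.mono hWU).continuousOn.isOpen_inter_preimage hW Metric.isOpen_ball,
    ⟨hx₀W, by simp [hΦ₀, hr]⟩, fun x hx ↦ hWU hx.1, k ∘ Φ,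
    hk.comp_contDiffOn (hΦ.mono fun x hx ↦ hWU hx.1), fun x hx ↦ ?_⟩
  have h1 := hbk (Φ x)
  have h2 : χ (Φ x) = 1 := χ.one_of_mem_closedBall (Metric.ball_subset_closedBall hx.2)
  have h3 : P.symm (Φ x) = x := by
    rw [← hPc]
    exact P.left_inv (hWsub hx.1).1.2
  simpa only [b, h2, h3, hℓΦ, one_mul, Function.comp] using h1

end Division

/-! ### Sections of vector bundles and coordinate fields -/

section HomBundle

variable {M : Type*} [TopologicalSpace M] [ChartedSpace Plane M]
  {F₁ F₂ : Type*} [NormedAddCommGroup F₁] [NormedSpace ℝ F₁] [FiniteDimensional ℝ F₁]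
  [NormedAddCommGroup F₂] [NormedSpace ℝ F₂]
  {V₁ V₂ : M → Type*} [TopologicalSpace (TotalSpace F₁ V₁)] [TopologicalSpace (TotalSpace F₂ V₂)]
  [∀ x, AddCommGroup (V₁ x)] [∀ x, Module ℝ (V₁ x)] [∀ x, TopologicalSpace (V₁ x)]
  [∀ x, AddCommGroup (V₂ x)] [∀ x, Module ℝ (V₂ x)] [∀ x, TopologicalSpace (V₂ x)]
  [∀ x, IsTopologicalAddGroup (V₂ x)] [∀ x, ContinuousSMul ℝ (V₂ x)]
  [FiberBundle F₁ V₁] [VectorBundle ℝ F₁ V₁] [ContMDiffVectorBundle ∞ F₁ V₁ (𝓡 2)]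
  [FiberBundle F₂ V₂] [VectorBundle ℝ F₂ V₂]

lemma contMDiffAt_clm_of_apply {F G : Type*} [NormedAddCommGroup F] [NormedSpace ℝ F]
    [FiniteDimensional ℝ F] [NormedAddCommGroup G] [NormedSpace ℝ G] {f : M → F →L[ℝ] G} {x : M}
    (h : ∀ w, ContMDiffAt (𝓡 2) 𝓘(ℝ, G) ∞ (fun y ↦ f y w) x) :
    ContMDiffAt (𝓡 2) 𝓘(ℝ, F →L[ℝ] G) ∞ f x := by
  -- a linear map is recovered from its values on a basis by a fixed continuous linear map
  let b := Module.finBasis ℝ F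
  let L : (Fin (Module.finrank ℝ F) → G) →L[ℝ] (F →L[ℝ] G) :=
    ∑ i, (ContinuousLinearMap.smulRightL ℝ F G (LinearMap.toContinuousLinearMap (b.coord i))).comp
      (ContinuousLinearMap.proj i)
  have hL : f = fun y ↦ L (fun i ↦ f y (b i)) := by
    funext y
    ext w
    conv_lhs => rw [← b.sum_repr w]
    simp [L, -Module.Basis.sum_repr]
  rw [hL]
  exact L.contMDiff.contMDiffAt.comp x (contMDiffAt_pi_space.2 fun i ↦ h (b i))

/-- A section of a bundle of linear maps is smooth if it maps smooth sections to smooth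
sections. -/
lemma contMDiffAt_hom_of_apply {φ : ∀ x : M, V₁ x →L[ℝ] V₂ x} {x₀ : M}
    (h : ∀ s : ∀ x, V₁ x,
      ContMDiffAt (𝓡 2) ((𝓡 2).prod 𝓘(ℝ, F₁)) ∞ (fun x ↦ TotalSpace.mk' F₁ x (s x)) x₀ →
      ContMDiffAt (𝓡 2) ((𝓡 2).prod 𝓘(ℝ, F₂)) ∞ (fun x ↦ TotalSpace.mk' F₂ x (φ x (s x))) x₀) :
    ContMDiffAt (𝓡 2) ((𝓡 2).prod 𝓘(ℝ, F₁ →L[ℝ] F₂)) ∞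
      (fun x ↦ TotalSpace.mk' (F₁ →L[ℝ] F₂) (E := fun x ↦ V₁ x →L[ℝ] V₂ x) x (φ x)) x₀ := by
  rw [contMDiffAt_hom_bundle]
  refine ⟨contMDiffAt_id, contMDiffAt_clm_of_apply fun w ↦ ?_⟩
  set e₁ := trivializationAt F₁ V₁ x₀
  have hx₁ : x₀ ∈ e₁.baseSet := FiberBundle.mem_baseSet_trivializationAt' x₀
  have hs : ContMDiffAt (𝓡 2) ((𝓡 2).prod 𝓘(ℝ, F₁)) ∞
      (fun x ↦ TotalSpace.mk' F₁ x (e₁.symmL ℝ x w)) x₀ := by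
    rw [e₁.contMDiffAt_section_iff hx₁]
    refine (contMDiffAt_const (c := w)).congr_of_eventuallyEq ?_
    filter_upwards [e₁.open_baseSet.mem_nhds hx₁] with x hx
    rw [e₁.symmL_apply hx]
    simp [hx]
  have := h _ hs
  rw [contMDiffAt_section] at this
  refine this.congr_of_eventuallyEq ?_
  filter_upwards [e₁.open_baseSet.mem_nhds hx₁, (trivializationAt F₂ V₂ x₀).open_baseSet.mem_nhds
    (FiberBundle.mem_baseSet_trivializationAt' x₀)] with x h1 h2
  simp [ContinuousLinearMap.inCoordinates, h2, e₁]

end HomBundle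

section CoordField

variable {M : Type*} [TopologicalSpace M] [ChartedSpace Plane M]
  {e : OpenPartialHomeomorph M Plane}

lemma isInvertible_mvfderiv_chart (he : e ∈ IsManifold.maximalAtlas (𝓡 2) ∞ M) {p : M}
    (hp : p ∈ e.source) : (mvfderiv (𝓡 2) e p).IsInvertible := by
  have h : e.MDifferentiable (𝓡 2) (𝓡 2) :=
    ⟨(contMDiffOn_of_mem_maximalAtlas he).mdifferentiableOn (by simp),
      (contMDiffOn_symm_of_mem_maximalAtlas he).mdifferentiableOn (by simp)⟩
  exact ⟨h.mfderiv hp, rfl⟩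

lemma mvfderiv_coordField (he : e ∈ IsManifold.maximalAtlas (𝓡 2) ∞ M) (i : Fin 2) {p : M}
    (hp : p ∈ e.source) :
    mvfderiv (𝓡 2) e p (coordField e i p) = EuclideanSpace.single i (1 : ℝ) :=
  (isInvertible_mvfderiv_chart he hp).self_apply_inverse _

lemma eq_sum_coordField (he : e ∈ IsManifold.maximalAtlas (𝓡 2) ∞ M) {p : M}
    (hp : p ∈ e.source) (v : TangentSpace (𝓡 2) p) :
    v = ∑ i, (mvfderiv (𝓡 2) e p v : Plane) i • coordField e i p := by
  obtain ⟨L, hL⟩ := isInvertible_mvfderiv_chart he hp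
  refine L.injective ?_
  have h (w) : L w = mvfderiv (𝓡 2) e p w := by rw [← hL]; rfl
  rw [map_sum]
  simp only [map_smul, h, mvfderiv_coordField he _ hp]
  ext j
  fin_cases j <;> simp [Fin.sum_univ_two]

variable [IsManifold (𝓡 2) ∞ M]

/-- The regularity under which Mathlib states the naturality of the Lie bracket. -/
instance isManifold_minSmoothness_two : IsManifold (𝓡 2) (minSmoothness ℝ 2) M := by
  rw [minSmoothness_of_isRCLikeNormedField]
  infer_instance

/-- The derivative of a smooth function along a smooth vector field is smooth. -/
lemma contMDiffAt_mvfderiv_apply {F : Type*} [NormedAddCommGroup F] [NormedSpace ℝ F] {f : M → F}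
    {X : ∀ p : M, TangentSpace (𝓡 2) p} {p : M} (hf : ContMDiffAt (𝓡 2) 𝓘(ℝ, F) ∞ f p)
    (hX : ContMDiffAt (𝓡 2) ((𝓡 2).prod (𝓡 2)) ∞ (fun q ↦ TotalSpace.mk' Plane q (X q)) p) :
    ContMDiffAt (𝓡 2) 𝓘(ℝ, F) ∞ (fun q ↦ mvfderiv (𝓡 2) f q (X q)) p := by
  have h1 : ContMDiffAt (𝓡 2) 𝓘(ℝ, F).tangent ∞
      (fun q ↦ (⟨f q, mfderiv (𝓡 2) 𝓘(ℝ, F) f q (X q)⟩ : TangentBundle 𝓘(ℝ, F) F)) p :=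
    ContMDiffAt.clm_apply_of_inCoordinates (hf.mfderiv_const (m := ∞) (by simp)) hX hf
  exact (contMDiff_snd_tangentBundle_modelSpace F 𝓘(ℝ, F)).contMDiffAt.comp p h1

lemma contMDiffAt_coordField (he : e ∈ IsManifold.maximalAtlas (𝓡 2) ∞ M) (i : Fin 2) {p : M}
    (hp : p ∈ e.source) :
    ContMDiffAt (𝓡 2) ((𝓡 2).prod (𝓡 2)) ∞ (fun q ↦ TotalSpace.mk' Plane q (coordField e i q)) p :=
  ContMDiffAt.mpullback_vectorField_preimage (n := ∞)
    (V := fun _ ↦ (EuclideanSpace.single i (1 : ℝ) : Plane))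
    (contMDiffAt_vectorSpace_iff_contDiffAt.2 contDiffAt_const)
    (contMDiffAt_of_mem_maximalAtlas he hp) (isInvertible_mvfderiv_chart he hp) (by simp)

/-- Coordinate fields commute. -/
lemma mlieBracket_coordField (he : e ∈ IsManifold.maximalAtlas (𝓡 2) ∞ M) (i j : Fin 2) {p : M}
    (hp : p ∈ e.source) :
    VectorField.mlieBracket (𝓡 2) (coordField e i) (coordField e j) p = 0 := by
  let V (k : Fin 2) (x : Plane) : TangentSpace (𝓡 2) x := (EuclideanSpace.single k (1 : ℝ) : Plane)
  have hc (k : Fin 2) : MDifferentiableAt (𝓡 2) (𝓡 2).tangent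
      (fun q ↦ (⟨q, V k q⟩ : TangentBundle (𝓡 2) Plane)) (e p) :=
    (contMDiffAt_vectorSpace_iff_contDiffAt (n := 1) (V := V k).2
      contDiffAt_const).mdifferentiableAt one_ne_zero
  have h := VectorField.mpullback_mlieBracket (I := 𝓡 2) (n := ∞) (hc i) (hc j)
    (contMDiffAt_of_mem_maximalAtlas he hp)
    (by rw [minSmoothness_of_isRCLikeNormedField]; exact ENat.LEInfty.out)
  have h0 : VectorField.mlieBracket (𝓡 2) (V i) (V j) (e p) = 0 := by
    rw [← VectorField.mlieBracketWithin_univ, VectorField.mlieBracketWithin_eq_lieBracketWithin]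
    simp [VectorField.lieBracketWithin, V]
    rfl
  rw [VectorField.mpullback_apply, h0, map_zero] at h
  exact h.symm

end CoordField

/-! ### Functions with non-degenerate zeros -/

section Nondegenerate

variable {M : Type*} [TopologicalSpace M] [ChartedSpace Plane M] {p : M} {f l : M → ℝ}

/-- A function with a non-degenerate zero at `p` does not vanish near `p`. -/
lemma frequently_ne_zero_of_mvfderiv_ne_zero (h : l p = 0 → mvfderiv (𝓡 2) l p ≠ 0) :
    ∃ᶠ q in 𝓝 p, l q ≠ 0 := by
  intro h0
  have h1 : l =ᶠ[𝓝 p] fun _ ↦ 0 := h0.mono fun q hq ↦ not_not.1 hq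
  refine h h1.self_of_nhds ?_
  rw [mvfderiv, h1.mfderiv_eq, mfderiv_const]
  exact ContinuousLinearMap.comp_zero _

lemma eq_zero_of_eventually_mul_eq_zero (h : l p = 0 → mvfderiv (𝓡 2) l p ≠ 0)
    (hf : ContinuousAt f p) (hlf : ∀ᶠ q in 𝓝 p, l q * f q = 0) : f p = 0 := by
  by_contra h0
  obtain ⟨q, hq, h1, h2⟩ := ((frequently_ne_zero_of_mvfderiv_ne_zero h).and_eventually
    (hlf.and (hf.eventually_ne h0))).exists
  exact (mul_ne_zero hq h2) h1

/-- Cancellation of a factor whose zeros are non-degenerate, hence nowhere dense. -/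
lemma eq_of_eventually_mul_eq_mul {k : M → ℝ} (h : l p = 0 → mvfderiv (𝓡 2) l p ≠ 0)
    (hf : ContinuousAt f p) (hk : ContinuousAt k p) (hlf : ∀ᶠ q in 𝓝 p, l q * f q = l q * k q) :
    f p = k p :=
  sub_eq_zero.1 <| eq_zero_of_eventually_mul_eq_zero (f := fun q ↦ f q - k q) h (hf.sub hk) <|
    hlf.mono fun q hq ↦ by rw [mul_sub, hq, sub_self]

/-- The derivative of a function on `M`, computed in a chart. -/
lemma mvfderiv_eq_fderiv_comp_chart {e : OpenPartialHomeomorph M Plane}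
    (he : e ∈ IsManifold.maximalAtlas (𝓡 2) ∞ M) (hp : p ∈ e.source)
    (hl : DifferentiableAt ℝ (l ∘ e.symm) (e p)) :
    mvfderiv (𝓡 2) l p = (fderiv ℝ (l ∘ e.symm) (e p)).comp (mvfderiv (𝓡 2) e p) := by
  have h1 : l =ᶠ[𝓝 p] (l ∘ e.symm) ∘ e := by
    filter_upwards [e.open_source.mem_nhds hp] with q hq
    simp [e.left_inv hq]
  rw [mvfderiv, h1.mfderiv_eq, mfderiv_comp p hl.mdifferentiableAt
    ((contMDiffAt_of_mem_maximalAtlas he hp).mdifferentiableAt (by simp)), mfderiv_eq_fderiv]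
  rfl

lemma contDiffAt_comp_chart_symm {e : OpenPartialHomeomorph M Plane}
    (he : e ∈ IsManifold.maximalAtlas (𝓡 2) ∞ M) (hp : p ∈ e.source)
    (hl : ContMDiffAt (𝓡 2) 𝓘(ℝ) ∞ l p) : ContDiffAt ℝ ∞ (l ∘ e.symm) (e p) := by
  rw [← contMDiffAt_iff_contDiffAt]
  refine ContMDiffAt.comp (e p) (I' := 𝓡 2) ?_
    (contMDiffAt_symm_of_mem_maximalAtlas he (e.map_source hp))
  rwa [e.left_inv hp]

/-- If `l² ≤ f₁ f₂` where `f₁, f₂ ≥ 0` vanish at `x₀`, then `l` vanishes to second order. -/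
lemma fderiv_eq_zero_of_sq_le_mul {l f₁ f₂ : Plane → ℝ} {x₀ : Plane}
    (h₁ : DifferentiableAt ℝ f₁ x₀) (h₂ : DifferentiableAt ℝ f₂ x₀)
    (h₁₀ : f₁ x₀ = 0) (h₂₀ : f₂ x₀ = 0)
    (hn₁ : ∀ᶠ x in 𝓝 x₀, 0 ≤ f₁ x) (hn₂ : ∀ᶠ x in 𝓝 x₀, 0 ≤ f₂ x)
    (hl : ∀ᶠ x in 𝓝 x₀, l x ^ 2 ≤ f₁ x * f₂ x) : fderiv ℝ l x₀ = 0 := by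
  have key {f : Plane → ℝ} (h : DifferentiableAt ℝ f x₀) (h₀ : f x₀ = 0)
      (hn : ∀ᶠ x in 𝓝 x₀, 0 ≤ f x) : f =o[𝓝 x₀] fun x ↦ ‖x - x₀‖ := by
    have hmin : IsLocalMin f x₀ := hn.mono fun x hx ↦ by rw [h₀]; exact hx
    have h1 := h.hasFDerivAt
    rw [hmin.fderiv_eq_zero, hasFDerivAt_iff_isLittleO] at h1
    simpa [h₀] using h1.norm_right
  have h3 : (fun x ↦ l x ^ 2) =o[𝓝 x₀] fun x ↦ ‖x - x₀‖ ^ 2 := by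
    have h4 := (key h₁ h₁₀ hn₁).mul (key h₂ h₂₀ hn₂)
    simp only [← pow_two] at h4
    refine Asymptotics.IsBigO.trans_isLittleO (Asymptotics.IsBigO.of_bound 1 ?_) h4
    filter_upwards [hl] with x hx
    rw [one_mul, Real.norm_of_nonneg (sq_nonneg _)]
    exact hx.trans (le_abs_self _)
  have h5 : l =o[𝓝 x₀] fun x ↦ ‖x - x₀‖ := h3.of_pow two_ne_zero
  have h6 : l x₀ = 0 := by
    have := hl.self_of_nhds
    rw [h₁₀, zero_mul] at this
    exact pow_eq_zero_iff two_ne_zero |>.1 (le_antisymm this (sq_nonneg _))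
  refine HasFDerivAt.fderiv ?_
  rw [hasFDerivAt_iff_isLittleO]
  simpa [h6] using h5.norm_right

/-- A smooth function which vanishes on the zero set of `l` is a smooth multiple of `l`, if the
zeros of `l` are non-degenerate. -/
lemma exists_contMDiffOn_eq_mul {e : OpenPartialHomeomorph M Plane}
    (he : e ∈ IsManifold.maximalAtlas (𝓡 2) ∞ M)
    (hf : ContMDiffOn (𝓡 2) 𝓘(ℝ) ∞ f e.source) (hl : ContMDiffOn (𝓡 2) 𝓘(ℝ) ∞ l e.source)
    (h : ∀ p ∈ e.source, l p = 0 → f p = 0)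
    (hdl : ∀ p ∈ e.source, l p = 0 → mvfderiv (𝓡 2) l p ≠ 0) :
    ∃ k : M → ℝ, ContMDiffOn (𝓡 2) 𝓘(ℝ) ∞ k e.source ∧ ∀ p ∈ e.source, f p = l p * k p := by
  classical
  have hsm {m : M → ℝ} (hm : ContMDiffOn (𝓡 2) 𝓘(ℝ) ∞ m e.source) :
      ContDiffOn ℝ ∞ (m ∘ e.symm) e.target := fun x hx ↦ by
    have h1 := e.map_target hx
    have h2 := contDiffAt_comp_chart_symm he h1 (hm.contMDiffAt (e.open_source.mem_nhds h1))
    rw [e.right_inv hx] at h2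
    exact h2.contDiffWithinAt
  have hloc : ∀ p ∈ e.source, ∃ k : M → ℝ, ContMDiffAt (𝓡 2) 𝓘(ℝ) ∞ k p ∧
      ∀ᶠ q in 𝓝 p, ContMDiffAt (𝓡 2) 𝓘(ℝ) ∞ k q ∧ f q = l q * k q := by
    intro p hp
    suffices H : ∃ k : M → ℝ,
        ∀ᶠ q in 𝓝 p, ContMDiffAt (𝓡 2) 𝓘(ℝ) ∞ k q ∧ f q = l q * k q by
      obtain ⟨k, hk⟩ := H
      exact ⟨k, hk.self_of_nhds.1, hk⟩
    have hfp := hf.contMDiffAt (e.open_source.mem_nhds hp)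
    have hlp := hl.contMDiffAt (e.open_source.mem_nhds hp)
    by_cases h0 : l p = 0
    · have hdl' : fderiv ℝ (l ∘ e.symm) (e p) ≠ 0 := fun h1 ↦ hdl p hp h0 <| by
        rw [mvfderiv_eq_fderiv_comp_chart he hp
          ((contDiffAt_comp_chart_symm he hp hlp).differentiableAt (by simp)), h1]
        exact ContinuousLinearMap.zero_comp _
      obtain ⟨V, hV, hpV, hVt, k, hk, hfk⟩ := exists_contDiffOn_eq_mul_nhds e.open_target
        (hsm hf) (hsm hl) (e.map_source hp) (by simp [e.left_inv hp, h0]) hdl'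
        (fun x hx hlx ↦ h _ (e.map_target hx) hlx)
      refine ⟨k ∘ e, ?_⟩
      filter_upwards [(e.isOpen_inter_preimage hV).mem_nhds ⟨hp, hpV⟩] with q hq
      refine ⟨(hk.contDiffAt (hV.mem_nhds hq.2)).contMDiffAt.comp q
        (contMDiffAt_of_mem_maximalAtlas he hq.1), ?_⟩
      simpa [e.left_inv hq.1] using hfk (e q) hq.2
    · refine ⟨fun q ↦ f q / l q, ?_⟩
      filter_upwards [e.open_source.mem_nhds hp, hlp.continuousAt.eventually_ne h0] with q hq hlq
      exact ⟨(hf.contMDiffAt (e.open_source.mem_nhds hq)).div₀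
        (hl.contMDiffAt (e.open_source.mem_nhds hq)) hlq, (mul_div_cancel₀ _ hlq).symm⟩
  choose! k hk hk' using hloc
  refine ⟨fun p ↦ k p p, fun p hp ↦ ?_, fun p hp ↦ (hk' p hp).self_of_nhds.2⟩
  refine ((hk p hp).congr_of_eventuallyEq ?_).contMDiffWithinAt
  -- the local quotients agree, since they agree off the zeros of `l`
  filter_upwards [(hk' p hp).eventually_nhds, e.open_source.mem_nhds hp] with q hq hqs
  refine eq_of_eventually_mul_eq_mul (hdl q hqs) (hk q hqs).continuousAt
    hq.self_of_nhds.1.continuousAt ?_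
  filter_upwards [hq, hk' q hqs] with x h1 h2
  rw [← h1.2, ← h2.2]

variable [IsManifold (𝓡 2) ∞ M]

lemma eventually_mvfderiv_ne_zero (hl : ContMDiffAt (𝓡 2) 𝓘(ℝ) ∞ l p)
    (h : mvfderiv (𝓡 2) l p ≠ 0) : ∀ᶠ q in 𝓝 p, mvfderiv (𝓡 2) l q ≠ 0 := by
  have he := IsManifold.chart_mem_maximalAtlas (I := 𝓡 2) (n := ∞) p
  have hp := mem_chart_source Plane p
  obtain ⟨i, hi⟩ : ∃ i, mvfderiv (𝓡 2) l p (coordField (chartAt Plane p) i p) ≠ 0 := by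
    by_contra! h0
    refine h (ContinuousLinearMap.ext fun v ↦ ?_)
    rw [eq_sum_coordField he hp v, map_sum]
    simp [h0]
  have hc := (contMDiffAt_mvfderiv_apply hl (contMDiffAt_coordField he i hp)).continuousAt
  filter_upwards [hc.eventually_ne hi] with q hq h0
  simp [h0] at hq

/-- If `f² = l²` and the zeros of `l` are non-degenerate, then `f = l` or `f = -l` locally: the
product `(f + l) (f - l)` vanishes, and one of its factors is either non-zero or has non-zero
derivative. -/
lemma eventually_eq_or_eq_neg_of_sq_eq_sq (hf : ContMDiffAt (𝓡 2) 𝓘(ℝ) ∞ f p)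
    (hl : ContMDiffAt (𝓡 2) 𝓘(ℝ) ∞ l p) (h : l p = 0 → mvfderiv (𝓡 2) l p ≠ 0)
    (hsq : ∀ᶠ q in 𝓝 p, f q ^ 2 = l q ^ 2) :
    (∀ᶠ q in 𝓝 p, f q = l q) ∨ ∀ᶠ q in 𝓝 p, f q = -l q := by
  have key {a b : M → ℝ} (ha : ContMDiffAt (𝓡 2) 𝓘(ℝ) ∞ a p) (hb : ContMDiffAt (𝓡 2) 𝓘(ℝ) ∞ b p)
      (hab : ∀ᶠ q in 𝓝 p, a q * b q = 0) (h0 : a p = 0 → mvfderiv (𝓡 2) a p ≠ 0) :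
      ∀ᶠ q in 𝓝 p, b q = 0 := by
    have h1 : ∀ᶠ q in 𝓝 p, a q = 0 → mvfderiv (𝓡 2) a q ≠ 0 := by
      by_cases hap : a p = 0
      · exact (eventually_mvfderiv_ne_zero ha (h0 hap)).mono fun q hq _ ↦ hq
      · exact (ha.continuousAt.eventually_ne hap).mono fun q hq hq' ↦ absurd hq' hq
    have h2 : ∀ᶠ q in 𝓝 p, ContMDiffAt (𝓡 2) 𝓘(ℝ) 1 b q :=
      (contMDiffAt_iff_contMDiffAt_nhds (by simp)).1 (hb.of_le (by simp))
    filter_upwards [h1, h2, hab.eventually_nhds] with q hq hbq habq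
    exact eq_zero_of_eventually_mul_eq_zero hq hbq.continuousAt habq
  have hm : ∀ᶠ q in 𝓝 p, (f q + l q) * (f q - l q) = 0 := hsq.mono fun q hq ↦ by linarith
  have hd {m : M → ℝ} (hm : ContMDiffAt (𝓡 2) 𝓘(ℝ) ∞ m p) : MDifferentiableAt (𝓡 2) 𝓘(ℝ) m p :=
    hm.mdifferentiableAt (by simp)
  by_cases h0 : f p + l p = 0 → mvfderiv (𝓡 2) (f + l) p ≠ 0
  · exact .inl ((key (hf.add hl) (hf.sub hl) hm h0).mono fun q hq ↦ sub_eq_zero.1 hq)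
  · refine .inr ((key (hf.sub hl) (hf.add hl) (hm.mono fun q hq ↦ by
      rw [mul_comm]; exact hq) fun h1 h2 ↦ ?_).mono fun q hq ↦ eq_neg_of_add_eq_zero_left hq)
    push Not at h0
    have h1 : f p - l p = 0 := h1
    have h3 := h0.2
    rw [mvfderiv_add (hd hf) (hd hl)] at h3
    rw [mvfderiv_fun_sub (hd hf) (hd hl)] at h2
    refine h (by linarith [h0.1]) (ContinuousLinearMap.ext fun v ↦ ?_)
    have h4 := DFunLike.congr_fun h3 v
    have h5 := DFunLike.congr_fun h2 v
    simp only [_root_.add_apply, _root_.sub_apply,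
      _root_.zero_apply] at h4 h5 ⊢
    linarith

end Nondegenerate

/-! ### The metric in local coordinates -/

namespace SemiMetric

variable {M : Type*} [TopologicalSpace M] [ChartedSpace Plane M] [IsManifold (𝓡 2) ∞ M]
  {g : SemiMetric M} {e : OpenPartialHomeomorph M Plane} {p : M}

lemma contMDiffAt_form {X Y : ∀ p : M, TangentSpace (𝓡 2) p}
    (hX : ContMDiffAt (𝓡 2) ((𝓡 2).prod (𝓡 2)) ∞ (fun q ↦ TotalSpace.mk' Plane q (X q)) p)
    (hY : ContMDiffAt (𝓡 2) ((𝓡 2).prod (𝓡 2)) ∞ (fun q ↦ TotalSpace.mk' Plane q (Y q)) p) :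
    ContMDiffAt (𝓡 2) 𝓘(ℝ) ∞ (fun q ↦ g.form q (X q) (Y q)) p := by
  have h : ContMDiffAt (𝓡 2) ((𝓡 2).prod 𝓘(ℝ)) ∞
      (fun q ↦ TotalSpace.mk' ℝ (E := Bundle.Trivial M ℝ) q (g.form q (X q) (Y q))) p :=
    ContMDiffAt.clm_bundle_apply₂ (F₁ := Plane) (F₂ := Plane) g.contMDiff.contMDiffAt hX hY
  rw [contMDiffAt_totalSpace] at h
  exact h.2

lemma contMDiffAt_coeffE (he : e ∈ IsManifold.maximalAtlas (𝓡 2) ∞ M) (hp : p ∈ e.source) :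
    ContMDiffAt (𝓡 2) 𝓘(ℝ) ∞ (g.coeffE e) p :=
  contMDiffAt_form (contMDiffAt_coordField he 0 hp) (contMDiffAt_coordField he 0 hp)

lemma contMDiffAt_coeffF (he : e ∈ IsManifold.maximalAtlas (𝓡 2) ∞ M) (hp : p ∈ e.source) :
    ContMDiffAt (𝓡 2) 𝓘(ℝ) ∞ (g.coeffF e) p :=
  contMDiffAt_form (contMDiffAt_coordField he 0 hp) (contMDiffAt_coordField he 1 hp)

lemma contMDiffAt_coeffG (he : e ∈ IsManifold.maximalAtlas (𝓡 2) ∞ M) (hp : p ∈ e.source) :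
    ContMDiffAt (𝓡 2) 𝓘(ℝ) ∞ (g.coeffG e) p :=
  contMDiffAt_form (contMDiffAt_coordField he 1 hp) (contMDiffAt_coordField he 1 hp)

lemma form_eq_coeff (he : e ∈ IsManifold.maximalAtlas (𝓡 2) ∞ M) (hp : p ∈ e.source)
    (v w : TangentSpace (𝓡 2) p) :
    letI x := (mvfderiv (𝓡 2) e p v : Plane)
    letI y := (mvfderiv (𝓡 2) e p w : Plane)
    g.form p v w = g.coeffE e p * (x 0 * y 0) + g.coeffF e p * (x 0 * y 1 + x 1 * y 0)
      + g.coeffG e p * (x 1 * y 1) := by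
  conv_lhs => rw [eq_sum_coordField he hp v, eq_sum_coordField he hp w]
  simp only [Fin.sum_univ_two, map_add, map_smul, _root_.add_apply,
    _root_.smul_apply, smul_eq_mul, coeffE, coeffF, coeffG,
    g.symm p (coordField e 1 p) (coordField e 0 p)]
  ring

lemma coeffE_nonneg (e : OpenPartialHomeomorph M Plane) (p : M) : 0 ≤ g.coeffE e p :=
  g.nonneg p _

lemma coeffG_nonneg (e : OpenPartialHomeomorph M Plane) (p : M) : 0 ≤ g.coeffG e p :=
  g.nonneg p _

/-- Where `E > 0`, the singular points are the zeros of the discriminant `E G - F²`. -/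
lemma isSingular_iff_of_coeffE_pos (he : e ∈ IsManifold.maximalAtlas (𝓡 2) ∞ M)
    (hp : p ∈ e.source) (hE : 0 < g.coeffE e p) {l : ℝ}
    (hl : g.coeffE e p * g.coeffG e p - g.coeffF e p ^ 2 = l ^ 2) : g.IsSingular p ↔ l = 0 := by
  have hsq (v : TangentSpace (𝓡 2) p) : g.coeffE e p * g.form p v v =
      (g.coeffE e p * (mvfderiv (𝓡 2) e p v : Plane) 0
        + g.coeffF e p * (mvfderiv (𝓡 2) e p v : Plane) 1) ^ 2
      + l ^ 2 * (mvfderiv (𝓡 2) e p v : Plane) 1 ^ 2 := by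
    rw [form_eq_coeff he hp, ← hl]; ring
  constructor
  · intro hs
    by_contra h0
    refine hs fun v hv ↦ ?_
    by_contra! hneg
    have h1 := hsq v
    have h2 : (0 : ℝ) < l ^ 2 := by positivity
    have h3 : g.coeffE e p * g.form p v v ≤ 0 := mul_nonpos_of_nonneg_of_nonpos hE.le hneg
    have h5 : l ^ 2 * (mvfderiv (𝓡 2) e p v : Plane) 1 ^ 2 ≤ 0 := by
      nlinarith [sq_nonneg (g.coeffE e p * (mvfderiv (𝓡 2) e p v : Plane) 0
        + g.coeffF e p * (mvfderiv (𝓡 2) e p v : Plane) 1)]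
    have h6 : (mvfderiv (𝓡 2) e p v : Plane) 1 = 0 := by
      by_contra h7
      have : 0 < l ^ 2 * (mvfderiv (𝓡 2) e p v : Plane) 1 ^ 2 := by positivity
      linarith
    rw [h6] at h1
    have h8 : (mvfderiv (𝓡 2) e p v : Plane) 0 = 0 := by
      by_contra h7
      have : 0 < (g.coeffE e p * (mvfderiv (𝓡 2) e p v : Plane) 0) ^ 2 := by positivity
      linarith [h1]
    refine hv ?_
    rw [eq_sum_coordField he hp v, Fin.sum_univ_two, h6, h8]
    simp
  · rintro rfl hpos
    let v : TangentSpace (𝓡 2) p :=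
      g.coeffE e p • coordField e 1 p - g.coeffF e p • coordField e 0 p
    have hv0 : (mvfderiv (𝓡 2) e p v : Plane) 0 = -g.coeffF e p := by
      simp [v, mvfderiv_coordField he _ hp]
    have hv1 : (mvfderiv (𝓡 2) e p v : Plane) 1 = g.coeffE e p := by
      simp [v, mvfderiv_coordField he _ hp]
    have h1 := hsq v
    rw [hv0, hv1] at h1
    have hv : v ≠ 0 := by
      intro h0
      rw [h0] at hv1
      simp at hv1
      exact hE.ne hv1
    have := hpos v hv
    nlinarith

/-- At a point where `E` and `G` vanish in some chart, the whole metric vanishes. -/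
lemma form_eq_zero_of_coeff_eq_zero (he : e ∈ IsManifold.maximalAtlas (𝓡 2) ∞ M)
    (hp : p ∈ e.source) (hE : g.coeffE e p = 0) (hG : g.coeffG e p = 0) {l : ℝ}
    (hl : g.coeffE e p * g.coeffG e p - g.coeffF e p ^ 2 = l ^ 2) (v w : TangentSpace (𝓡 2) p) :
    g.form p v w = 0 := by
  have hF : g.coeffF e p = 0 := by
    rw [hE, zero_mul] at hl
    nlinarith [sq_nonneg (g.coeffF e p), sq_nonneg l]
  rw [form_eq_coeff he hp, hE, hF, hG]
  ring

/-- The metric of a Kossowski metric does not vanish at any point: at a zero, `E` and `G` would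
vanish to second order, so that `lam² ≤ E G` would force `d lam = 0`. -/
lemma IsKossowski.coeff_pos (hg : g.IsKossowski) (he : e ∈ IsManifold.maximalAtlas (𝓡 2) ∞ M)
    (hp : p ∈ e.source) : 0 < g.coeffE e p ∨ 0 < g.coeffG e p := by
  by_contra! h
  have hE := le_antisymm h.1 (coeffE_nonneg e p)
  have hG := le_antisymm h.2 (coeffG_nonneg e p)
  obtain ⟨U, hU, hpU, hUe, lam, hlam⟩ := hg.1.2 e he p hp
  have h0 := form_eq_zero_of_coeff_eq_zero he hp hE hG (hlam.2 p hpU)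
  have hs : g.IsSingular p := fun hpos ↦ by
    have h1 := hpos (coordField e 0 p) fun h2 ↦ by
      have h3 := mvfderiv_coordField he 0 hp
      rw [h2, map_zero] at h3
      have := congrArg (fun x : Plane ↦ x 0) h3
      simp at this
    exact h1.ne' (h0 _ _)
  refine hg.2 p hs e he U hU hpU hUe lam hlam ?_
  have hl := contDiffAt_comp_chart_symm he hp (hlam.1.contMDiffAt (hU.mem_nhds hpU))
  rw [mvfderiv_eq_fderiv_comp_chart he hp (hl.differentiableAt (by simp)),
    fderiv_eq_zero_of_sq_le_mul (f₁ := g.coeffE e ∘ e.symm) (f₂ := g.coeffG e ∘ e.symm)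
    ((contDiffAt_comp_chart_symm he hp (contMDiffAt_coeffE he hp)).differentiableAt (by simp))
    ((contDiffAt_comp_chart_symm he hp (contMDiffAt_coeffG he hp)).differentiableAt (by simp))
    (by simp [e.left_inv hp, hE]) (by simp [e.left_inv hp, hG])
    (.of_forall fun x ↦ coeffE_nonneg _ _) (.of_forall fun x ↦ coeffG_nonneg _ _) ?_]
  · exact ContinuousLinearMap.zero_comp _
  · filter_upwards [(e.continuousAt_symm (e.map_source hp)).preimage_mem_nhds
      (by rw [e.left_inv hp]; exact hU.mem_nhds hpU)] with x hx
    have h1 := hlam.2 _ hx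
    simp only [Function.comp]
    nlinarith [sq_nonneg (g.coeffF e (e.symm x))]

/-- The coordinate change `(u, v) ↦ (v, u)`. -/
def swapPlane : Plane ≃L[ℝ] Plane :=
  (LinearIsometryEquiv.piLpCongrLeft 2 ℝ ℝ (Equiv.swap (0 : Fin 2) 1)).toContinuousLinearEquiv

/-- The coordinate system `(v, u)` obtained from `(u, v)`. -/
def swapChart (e : OpenPartialHomeomorph M Plane) : OpenPartialHomeomorph M Plane :=
  e.transHomeomorph swapPlane.toHomeomorph

lemma swapChart_mem_maximalAtlas (he : e ∈ IsManifold.maximalAtlas (𝓡 2) ∞ M) :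
    swapChart e ∈ IsManifold.maximalAtlas (𝓡 2) ∞ M := by
  refine OpenPartialHomeomorph.mem_maximalAtlas_of_contMDiffOn (I := 𝓡 2) (n := ∞)
    (φ := swapChart e) ?_ ?_
  · exact swapPlane.contDiff.contMDiff.comp_contMDiffOn (contMDiffOn_of_mem_maximalAtlas he)
  · exact (contMDiffOn_symm_of_mem_maximalAtlas he).comp
      swapPlane.symm.contDiff.contMDiff.contMDiffOn fun x hx ↦ hx

lemma coordField_swapChart (he : e ∈ IsManifold.maximalAtlas (𝓡 2) ∞ M) (hp : p ∈ e.source) :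
    coordField (swapChart e) 0 p = coordField e 1 p := by
  have he' := swapChart_mem_maximalAtlas he
  have hd : mvfderiv (𝓡 2) (swapChart e) p (coordField e 1 p)
      = EuclideanSpace.single 0 (1 : ℝ) := by
    have h1 : mfderiv (𝓡 2) 𝓘(ℝ, Plane) (swapPlane ∘ e) p = _ :=
      mfderiv_comp p swapPlane.differentiableAt.mdifferentiableAt
        ((contMDiffAt_of_mem_maximalAtlas he hp).mdifferentiableAt (by simp))
    have h2 : mvfderiv (𝓡 2) (swapChart e) p (coordField e 1 p)
        = swapPlane (mvfderiv (𝓡 2) e p (coordField e 1 p)) := by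
      have h3 := DFunLike.congr_fun h1 (coordField e 1 p)
      rw [mfderiv_eq_fderiv, swapPlane.fderiv] at h3
      exact h3
    rw [h2, mvfderiv_coordField he _ hp]
    ext i
    fin_cases i <;> simp [swapPlane]
  have hp' : p ∈ (swapChart e).source := hp
  refine (isInvertible_mvfderiv_chart he' hp').injective ?_
  rw [hd, mvfderiv_coordField he' 0 hp']

/-- The domains of the coordinate systems with `E > 0` which carry an area density cover `M`. -/
lemma IsKossowski.exists_frameChart (hg : g.IsKossowski) (p : M) :
    ∃ α : g.FrameChart, p ∈ α.chart.source := by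
  obtain ⟨e, he, hp, hE⟩ : ∃ e ∈ IsManifold.maximalAtlas (𝓡 2) ∞ M, p ∈ e.source ∧
      0 < g.coeffE e p := by
    have he := IsManifold.chart_mem_maximalAtlas (I := 𝓡 2) (n := ∞) p
    have hp := mem_chart_source Plane p
    rcases hg.coeff_pos he hp with h | h
    · exact ⟨_, he, hp, h⟩
    · refine ⟨swapChart (chartAt Plane p), swapChart_mem_maximalAtlas he, hp, ?_⟩
      simpa only [coeffE, coordField_swapChart he hp, coeffG] using h
  obtain ⟨U, hU, hpU, hUe, lam, hlam⟩ := hg.1.2 e he p hp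
  obtain ⟨W, hW, hWo, hpW⟩ := eventually_nhds_iff.1
    ((contMDiffAt_coeffE (g := g) he hp).continuousAt.eventually (lt_mem_nhds hE))
  have hsub : (e.restr (U ∩ W)).source ⊆ U ∩ W := by
    rw [e.restr_source' _ (hU.inter hWo)]
    exact Set.inter_subset_right
  exact ⟨⟨e.restr (U ∩ W), restr_mem_maximalAtlas _ he (hU.inter hWo), lam,
    ⟨hlam.1.mono fun q hq ↦ (hsub hq).1, fun q hq ↦ hlam.2 q (hsub hq).1⟩,
    fun q hq ↦ hW q (hsub hq).2⟩, by
      rw [e.restr_source' _ (hU.inter hWo)]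
      exact ⟨hp, hpU, hpW⟩⟩

end SemiMetric

/-! ### Orthonormal coframes and transition matrices -/

section Sign

open scoped Classical in
/-- The sign `σ = ±1` with `f = σ l` near `p`, for functions with `f² = l²`; it is set to `-1` if
`f ≠ l` near `p`. -/
def localSign {M : Type*} [TopologicalSpace M] (f l : M → ℝ) (p : M) : ℝ :=
  if ∀ᶠ q in 𝓝 p, f q = l q then 1 else -1

lemma localSign_sq {M : Type*} [TopologicalSpace M] {p : M} {f l : M → ℝ} :
    localSign f l p ^ 2 = 1 := by
  unfold localSign; split_ifs <;> norm_num

variable {M : Type*} [TopologicalSpace M] [ChartedSpace Plane M] {p : M} {f l : M → ℝ}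

lemma eq_of_eventually_eq_mul (h : l p = 0 → mvfderiv (𝓡 2) l p ≠ 0) {c d : ℝ}
    (hc : ∀ᶠ q in 𝓝 p, f q = c * l q) (hd : ∀ᶠ q in 𝓝 p, f q = d * l q) : c = d := by
  obtain ⟨q, hq, h1, h2⟩ := ((frequently_ne_zero_of_mvfderiv_ne_zero h).and_eventually
    (hc.and hd)).exists
  exact mul_right_cancel₀ hq (h1.symm.trans h2)

variable [IsManifold (𝓡 2) ∞ M]

lemma eventually_eq_localSign_mul (hf : ContMDiffAt (𝓡 2) 𝓘(ℝ) ∞ f p)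
    (hl : ContMDiffAt (𝓡 2) 𝓘(ℝ) ∞ l p) (h : l p = 0 → mvfderiv (𝓡 2) l p ≠ 0)
    (hsq : ∀ᶠ q in 𝓝 p, f q ^ 2 = l q ^ 2) :
    ∀ᶠ q in 𝓝 p, f q = localSign f l p * l q := by
  unfold localSign
  split_ifs with h1
  · simpa using h1
  · simpa using (eventually_eq_or_eq_neg_of_sq_eq_sq hf hl h hsq).resolve_left h1

/-- The relative sign of `f` and `l` is locally constant. -/
lemma eventually_localSign_eq {U : Set M} (hU : IsOpen U) (hp : p ∈ U)
    (hf : ContMDiffOn (𝓡 2) 𝓘(ℝ) ∞ f U) (hl : ContMDiffOn (𝓡 2) 𝓘(ℝ) ∞ l U)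
    (h : ∀ q ∈ U, l q = 0 → mvfderiv (𝓡 2) l q ≠ 0) (hsq : ∀ q ∈ U, f q ^ 2 = l q ^ 2) :
    ∀ᶠ q in 𝓝 p, localSign f l q = localSign f l p := by
  have key {q : M} (hq : q ∈ U) : ∀ᶠ x in 𝓝 q, f x = localSign f l q * l x :=
    eventually_eq_localSign_mul (hf.contMDiffAt (hU.mem_nhds hq)) (hl.contMDiffAt (hU.mem_nhds hq))
      (h q hq) (Filter.eventually_of_mem (hU.mem_nhds hq) hsq)
  filter_upwards [(key hp).eventually_nhds, hU.mem_nhds hp] with q hq hqU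
  exact eq_of_eventually_eq_mul (h q hqU) (key hqU) hq

end Sign

namespace SemiMetric.FrameChart

variable {M : Type*} [TopologicalSpace M] [ChartedSpace Plane M] [IsManifold (𝓡 2) ∞ M]
  {g : SemiMetric M} (α β γ : g.FrameChart) {p : M}

/-- The matrix `S = T⁻¹`, which unlike `T` is smooth across the singular set. -/
def coframeMatrix (p : M) : Matrix (Fin 2) (Fin 2) ℝ :=
  !![√(g.coeffE α.chart p), g.coeffF α.chart p / √(g.coeffE α.chart p);
     0, α.lam p / √(g.coeffE α.chart p)]

/-- The smooth coframe `(η₀, η₁) = S (du, dv)`, which is dual to `(e₁, e₂)` off the singular set. -/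
def coframe (i : Fin 2) (p : M) : TangentSpace (𝓡 2) p →L[ℝ] ℝ :=
  ∑ j, α.coframeMatrix p i j •
    ((EuclideanSpace.proj j : Plane →L[ℝ] ℝ).comp (mvfderiv (𝓡 2) α.chart p))

/-- The area form `η₀ ∧ η₁ = lam du ∧ dv`, evaluated on a pair of tangent vectors. -/
def area (p : M) (v w : TangentSpace (𝓡 2) p) : ℝ :=
  α.coframe 0 p v * α.coframe 1 p w - α.coframe 1 p v * α.coframe 0 p w

variable {α β γ}

lemma sqrt_coeffE_pos (hp : p ∈ α.chart.source) : 0 < √(g.coeffE α.chart p) :=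
  Real.sqrt_pos.2 (α.coeffE_pos p hp)

lemma mul_self_sqrt_coeffE (hp : p ∈ α.chart.source) :
    √(g.coeffE α.chart p) * √(g.coeffE α.chart p) = g.coeffE α.chart p :=
  Real.mul_self_sqrt (α.coeffE_pos p hp).le

lemma contMDiffAt_lam (hp : p ∈ α.chart.source) : ContMDiffAt (𝓡 2) 𝓘(ℝ) ∞ α.lam p :=
  α.isAreaDensityOn.1.contMDiffAt (α.chart.open_source.mem_nhds hp)

lemma contMDiffAt_sqrt_coeffE (hp : p ∈ α.chart.source) :
    ContMDiffAt (𝓡 2) 𝓘(ℝ) ∞ (fun q ↦ √(g.coeffE α.chart q)) p :=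
  (Real.contDiffAt_sqrt (α.coeffE_pos p hp).ne').contMDiffAt.comp p
    (contMDiffAt_coeffE α.mem_maximalAtlas hp)

lemma contMDiffAt_coframeMatrix (hp : p ∈ α.chart.source) (i j : Fin 2) :
    ContMDiffAt (𝓡 2) 𝓘(ℝ) ∞ (fun q ↦ α.coframeMatrix q i j) p := by
  have h := contMDiffAt_sqrt_coeffE hp
  fin_cases i <;> fin_cases j
  · exact h
  · exact (contMDiffAt_coeffF α.mem_maximalAtlas hp).div₀ h (sqrt_coeffE_pos hp).ne'
  · exact contMDiffAt_const
  · exact (contMDiffAt_lam hp).div₀ h (sqrt_coeffE_pos hp).ne'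

lemma coframe_apply (i : Fin 2) (v : TangentSpace (𝓡 2) p) : α.coframe i p v =
    α.coframeMatrix p i 0 * (mvfderiv (𝓡 2) α.chart p v : Plane) 0
      + α.coframeMatrix p i 1 * (mvfderiv (𝓡 2) α.chart p v : Plane) 1 := by
  simp [coframe, Fin.sum_univ_two]

lemma coframe_coordField (hp : p ∈ α.chart.source) (i j : Fin 2) :
    α.coframe i p (coordField α.chart j p) = α.coframeMatrix p i j := by
  rw [coframe_apply, mvfderiv_coordField α.mem_maximalAtlas j hp]
  fin_cases j <;> simp

/-- The metric is `η₀² + η₁²`. -/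
lemma form_eq_sum_coframe (hp : p ∈ α.chart.source) (v w : TangentSpace (𝓡 2) p) :
    g.form p v w = α.coframe 0 p v * α.coframe 0 p w + α.coframe 1 p v * α.coframe 1 p w := by
  have h0 := (sqrt_coeffE_pos hp).ne'
  have h1 := mul_self_sqrt_coeffE hp
  have h2 := α.isAreaDensityOn.2 p hp
  have h3 : g.coeffG α.chart p = g.coeffF α.chart p / √(g.coeffE α.chart p) *
      (g.coeffF α.chart p / √(g.coeffE α.chart p)) + α.lam p / √(g.coeffE α.chart p) *
      (α.lam p / √(g.coeffE α.chart p)) := by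
    rw [div_mul_div_comm, div_mul_div_comm, h1, ← add_div, eq_div_iff (α.coeffE_pos p hp).ne']
    linarith
  have h4 : g.coeffF α.chart p = √(g.coeffE α.chart p) *
      (g.coeffF α.chart p / √(g.coeffE α.chart p)) := (mul_div_cancel₀ _ h0).symm
  rw [form_eq_coeff α.mem_maximalAtlas hp]
  simp only [coframe_apply, coframeMatrix, of_apply, cons_val', cons_val_zero, cons_val_one,
    cons_val_fin_one]
  set x := (mvfderiv (𝓡 2) α.chart p v : Plane)
  set y := (mvfderiv (𝓡 2) α.chart p w : Plane)
  linear_combination -(x 0 * y 0) * h1 + (x 0 * y 1 + x 1 * y 0) * h4 + x 1 * y 1 * h3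

lemma area_eq_lam_mul (hp : p ∈ α.chart.source) (v w : TangentSpace (𝓡 2) p) :
    letI x := (mvfderiv (𝓡 2) α.chart p v : Plane)
    letI y := (mvfderiv (𝓡 2) α.chart p w : Plane)
    α.area p v w = α.lam p * (x 0 * y 1 - x 1 * y 0) := by
  have h4 : α.lam p = √(g.coeffE α.chart p) * (α.lam p / √(g.coeffE α.chart p)) :=
    (mul_div_cancel₀ _ (sqrt_coeffE_pos hp).ne').symm
  simp only [area, coframe_apply, coframeMatrix, of_apply, cons_val', cons_val_zero, cons_val_one,
    cons_val_fin_one]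
  set x := (mvfderiv (𝓡 2) α.chart p v : Plane)
  set y := (mvfderiv (𝓡 2) α.chart p w : Plane)
  linear_combination -(x 0 * y 1 - x 1 * y 0) * h4

lemma area_coordField_self (hp : p ∈ α.chart.source) :
    α.area p (coordField α.chart 0 p) (coordField α.chart 1 p) = α.lam p := by
  rw [area_eq_lam_mul hp, mvfderiv_coordField α.mem_maximalAtlas _ hp,
    mvfderiv_coordField α.mem_maximalAtlas _ hp]
  simp

lemma area_coordField_sq (hα : p ∈ α.chart.source) (hβ : p ∈ β.chart.source) :
    α.area p (coordField β.chart 0 p) (coordField β.chart 1 p) ^ 2 = β.lam p ^ 2 := by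
  rw [← β.isAreaDensityOn.2 p hβ, coeffE, coeffF, coeffG, form_eq_sum_coframe hα,
    form_eq_sum_coframe hα, form_eq_sum_coframe hα, area]
  ring

lemma contMDiffAt_coframe_apply (hp : p ∈ α.chart.source) (i : Fin 2)
    {X : ∀ p : M, TangentSpace (𝓡 2) p}
    (hX : ContMDiffAt (𝓡 2) ((𝓡 2).prod (𝓡 2)) ∞ (fun q ↦ TotalSpace.mk' Plane q (X q)) p) :
    ContMDiffAt (𝓡 2) 𝓘(ℝ) ∞ (fun q ↦ α.coframe i q (X q)) p := by
  have h1 (j : Fin 2) : ContMDiffAt (𝓡 2) 𝓘(ℝ) ∞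
      (fun q ↦ (mvfderiv (𝓡 2) α.chart q (X q) : Plane) j) p :=
    (EuclideanSpace.proj j : Plane →L[ℝ] ℝ).contMDiff.contMDiffAt.comp p
      (contMDiffAt_mvfderiv_apply (contMDiffAt_of_mem_maximalAtlas α.mem_maximalAtlas hp) hX)
  simp only [coframe_apply]
  exact ((contMDiffAt_coframeMatrix hp i 0).mul (h1 0)).add
    ((contMDiffAt_coframeMatrix hp i 1).mul (h1 1))

lemma contMDiffAt_area_apply (hp : p ∈ α.chart.source) {X Y : ∀ p : M, TangentSpace (𝓡 2) p}
    (hX : ContMDiffAt (𝓡 2) ((𝓡 2).prod (𝓡 2)) ∞ (fun q ↦ TotalSpace.mk' Plane q (X q)) p)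
    (hY : ContMDiffAt (𝓡 2) ((𝓡 2).prod (𝓡 2)) ∞ (fun q ↦ TotalSpace.mk' Plane q (Y q)) p) :
    ContMDiffAt (𝓡 2) 𝓘(ℝ) ∞ (fun q ↦ α.area q (X q) (Y q)) p :=
  ((contMDiffAt_coframe_apply hp 0 hX).mul (contMDiffAt_coframe_apply hp 1 hY)).sub
    ((contMDiffAt_coframe_apply hp 1 hX).mul (contMDiffAt_coframe_apply hp 0 hY))

lemma isSingular_iff (hp : p ∈ α.chart.source) : g.IsSingular p ↔ α.lam p = 0 :=
  isSingular_iff_of_coeffE_pos α.mem_maximalAtlas hp (α.coeffE_pos p hp)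
    (α.isAreaDensityOn.2 p hp)

lemma mvfderiv_lam_ne_zero (hg : g.IsKossowski) (hp : p ∈ α.chart.source) (h : α.lam p = 0) :
    mvfderiv (𝓡 2) α.lam p ≠ 0 :=
  hg.2 p ((isSingular_iff hp).2 h) α.chart α.mem_maximalAtlas α.chart.source
    α.chart.open_source hp subset_rfl α.lam α.isAreaDensityOn

lemma coframeMatrix_mul_frameMatrix (hp : p ∈ α.chart.source) (h : α.lam p ≠ 0) :
    α.coframeMatrix p * α.frameMatrix p = 1 := by
  have h0 := (sqrt_coeffE_pos hp).ne'
  ext i j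
  fin_cases i <;> fin_cases j <;>
    simp [coframeMatrix, frameMatrix, Matrix.mul_apply, Fin.sum_univ_two] <;> field_simp
  ring

lemma coframe_tangentFrame (hp : p ∈ α.chart.source) (h : α.lam p ≠ 0) (i j : Fin 2) :
    α.coframe i p (α.tangentFrame j p) = if i = j then 1 else 0 := by
  have h1 := congrFun (congrFun (coframeMatrix_mul_frameMatrix hp h) i) j
  rw [Matrix.mul_apply, Matrix.one_apply] at h1
  rw [← h1, tangentFrame, map_sum]
  simp [coframe_coordField hp, mul_comm]

variable (α β)

/-- The sign `ε = ±1` with `η₀ ∧ η₁ = ε η₀' ∧ η₁'` near `p`, for the coframes of `α` and `β`. -/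
def transSign (p : M) : ℝ :=
  localSign (fun q ↦ α.area q (coordField β.chart 0 q) (coordField β.chart 1 q)) β.lam p

/-- The smooth extension of the transition matrix `T_α⁻¹ J_αβ T_β`: the first column is the unit
vector `T_α⁻¹ J_αβ (1 / √E_β, 0)`, the second one is its rotation by `± π / 2`. -/
def trans (p : M) : Matrix (Fin 2) (Fin 2) ℝ :=
  letI x := α.coframe 0 p (coordField β.chart 0 p) / √(g.coeffE β.chart p)
  letI y := α.coframe 1 p (coordField β.chart 0 p) / √(g.coeffE β.chart p)
  !![x, -(α.transSign β p * y); y, α.transSign β p * x]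

variable {α β}

lemma eventually_area_eq (hg : g.IsKossowski) (hα : p ∈ α.chart.source)
    (hβ : p ∈ β.chart.source) :
    ∀ᶠ q in 𝓝 p, α.area q (coordField β.chart 0 q) (coordField β.chart 1 q)
      = α.transSign β p * β.lam q := by
  refine eventually_eq_localSign_mul (contMDiffAt_area_apply hα
    (contMDiffAt_coordField β.mem_maximalAtlas 0 hβ)
    (contMDiffAt_coordField β.mem_maximalAtlas 1 hβ)) (contMDiffAt_lam hβ)
    (mvfderiv_lam_ne_zero hg hβ) ?_
  filter_upwards [α.chart.open_source.mem_nhds hα, β.chart.open_source.mem_nhds hβ] with q h1 h2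
  exact area_coordField_sq h1 h2

lemma eventually_transSign_eq (hg : g.IsKossowski) (hα : p ∈ α.chart.source)
    (hβ : p ∈ β.chart.source) : ∀ᶠ q in 𝓝 p, α.transSign β q = α.transSign β p := by
  refine eventually_localSign_eq (α.chart.open_source.inter β.chart.open_source) ⟨hα, hβ⟩
    (fun q hq ↦ (contMDiffAt_area_apply hq.1 (contMDiffAt_coordField β.mem_maximalAtlas 0 hq.2)
      (contMDiffAt_coordField β.mem_maximalAtlas 1 hq.2)).contMDiffWithinAt)
    (fun q hq ↦ (contMDiffAt_lam hq.2).contMDiffWithinAt)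
    (fun q hq ↦ mvfderiv_lam_ne_zero hg hq.2) fun q hq ↦ area_coordField_sq hq.1 hq.2

/-- The first column of the transition matrix is a unit vector. -/
lemma trans_sq_add_sq (hα : p ∈ α.chart.source) (hβ : p ∈ β.chart.source) :
    α.trans β p 0 0 ^ 2 + α.trans β p 1 0 ^ 2 = 1 := by
  have h1 := form_eq_sum_coframe hα (coordField β.chart 0 p) (coordField β.chart 0 p)
  have h2 : g.form p (coordField β.chart 0 p) (coordField β.chart 0 p) = g.coeffE β.chart p := rfl
  rw [h2, ← mul_self_sqrt_coeffE hβ] at h1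
  have h0 := (sqrt_coeffE_pos hβ).ne'
  simp only [trans, of_apply, cons_val', cons_val_zero, cons_val_one, cons_val_fin_one]
  rw [div_pow, div_pow, ← add_div, div_eq_one_iff_eq (pow_ne_zero 2 h0)]
  linarith

lemma trans_apply_zero_one : α.trans β p 0 1 = -(α.transSign β p * α.trans β p 1 0) := by
  simp [trans]

lemma trans_apply_one_one : α.trans β p 1 1 = α.transSign β p * α.trans β p 0 0 := by
  simp [trans]

lemma trans_mem_orthogonalGroup (hα : p ∈ α.chart.source) (hβ : p ∈ β.chart.source) :
    α.trans β p ∈ Matrix.orthogonalGroup (Fin 2) ℝ := by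
  have h1 := trans_sq_add_sq hα hβ
  have h2 : α.transSign β p ^ 2 = 1 := localSign_sq
  rw [Matrix.mem_orthogonalGroup_iff']
  ext i j
  fin_cases i <;> fin_cases j <;>
    simp [Matrix.mul_apply, Fin.sum_univ_two, trans_apply_zero_one,
      trans_apply_one_one]
  · linear_combination h1
  · ring
  · ring
  · linear_combination α.transSign β p ^ 2 * h1 + h2

lemma contMDiffAt_trans (hg : g.IsKossowski) (hα : p ∈ α.chart.source) (hβ : p ∈ β.chart.source)
    (i j : Fin 2) : ContMDiffAt (𝓡 2) 𝓘(ℝ) ∞ (fun q ↦ α.trans β q i j) p := by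
  have h0 (i : Fin 2) : ContMDiffAt (𝓡 2) 𝓘(ℝ) ∞ (fun q ↦ α.trans β q i 0) p := by
    have h1 (k : Fin 2) := (contMDiffAt_coframe_apply hα k
      (contMDiffAt_coordField β.mem_maximalAtlas 0 hβ)).div₀ (contMDiffAt_sqrt_coeffE hβ)
      (sqrt_coeffE_pos hβ).ne'
    fin_cases i
    · exact h1 0
    · exact h1 1
  have hs : ContMDiffAt (𝓡 2) 𝓘(ℝ) ∞ (α.transSign β) p :=
    contMDiffAt_const.congr_of_eventuallyEq (eventually_transSign_eq hg hα hβ)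
  fin_cases i <;> fin_cases j
  · exact h0 0
  · exact (hs.mul (h0 1)).neg.congr_of_eventuallyEq (.of_forall fun q ↦ trans_apply_zero_one)
  · exact h0 1
  · exact (hs.mul (h0 0)).congr_of_eventuallyEq (.of_forall fun q ↦ trans_apply_one_one)

/-- The coframes transform by the transition matrix, across the singular set. -/
lemma coframe_eq_sum_trans (hg : g.IsKossowski) (hα : p ∈ α.chart.source)
    (hβ : p ∈ β.chart.source) (i : Fin 2) (v : TangentSpace (𝓡 2) p) :
    α.coframe i p v = ∑ j, α.trans β p i j * β.coframe j p v := by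
  have h0 := (sqrt_coeffE_pos hβ).ne'
  have h1 := trans_sq_add_sq hα hβ
  have hu (i : Fin 2) : α.coframe i p (coordField β.chart 0 p)
      = α.trans β p i 0 * √(g.coeffE β.chart p) := by
    fin_cases i <;> simp [trans, h0]
  have hF := form_eq_sum_coframe hα (coordField β.chart 0 p) (coordField β.chart 1 p)
  have hF' : g.form p (coordField β.chart 0 p) (coordField β.chart 1 p) = g.coeffF β.chart p := rfl
  have hA := (eventually_area_eq hg hα hβ).self_of_nhds
  rw [area, hu, hu] at hA
  rw [hF', hu, hu] at hF
  -- the components of `η(∂_v)` along the first column and its rotation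
  have hF2 : α.trans β p 0 0 * α.coframe 0 p (coordField β.chart 1 p)
      + α.trans β p 1 0 * α.coframe 1 p (coordField β.chart 1 p) = β.coframeMatrix p 0 1 := by
    simp only [coframeMatrix, of_apply, cons_val', cons_val_zero, cons_val_one, cons_val_fin_one]
    rw [eq_div_iff h0, hF]
    ring
  have hA2 : α.trans β p 0 0 * α.coframe 1 p (coordField β.chart 1 p)
      - α.trans β p 1 0 * α.coframe 0 p (coordField β.chart 1 p)
      = α.transSign β p * β.coframeMatrix p 1 1 := by
    simp only [coframeMatrix, of_apply, cons_val', cons_val_one, cons_val_fin_one]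
    rw [mul_div_assoc', eq_div_iff h0, ← hA]
    ring
  have key (k : Fin 2) : α.coframe i p (coordField β.chart k p)
      = ∑ j, α.trans β p i j * β.coframe j p (coordField β.chart k p) := by
    simp only [Fin.sum_univ_two, coframe_coordField hβ]
    fin_cases k
    · simp only [Fin.zero_eta, hu]
      simp [coframeMatrix]
    · fin_cases i
      · simp only [Fin.zero_eta, Fin.mk_one, trans_apply_zero_one]
        linear_combination α.trans β p 0 0 * hF2 - α.trans β p 1 0 * hA2
          - α.coframe 0 p (coordField β.chart 1 p) * h1
      · simp only [Fin.mk_one, trans_apply_one_one]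
        linear_combination α.trans β p 1 0 * hF2 + α.trans β p 0 0 * hA2
          - α.coframe 1 p (coordField β.chart 1 p) * h1
  rw [eq_sum_coordField β.mem_maximalAtlas hβ v, map_sum]
  simp only [Fin.sum_univ_two, map_add, map_smul, smul_eq_mul] at key ⊢
  rw [key 0, key 1]
  ring

lemma area_eq_transSign_mul (hg : g.IsKossowski) (hα : p ∈ α.chart.source)
    (hβ : p ∈ β.chart.source) (v w : TangentSpace (𝓡 2) p) :
    α.area p v w = α.transSign β p * β.area p v w := by
  have h1 := trans_sq_add_sq hα hβ
  simp only [area, coframe_eq_sum_trans hg hα hβ, Fin.sum_univ_two, trans_apply_zero_one,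
    trans_apply_one_one]
  linear_combination (α.transSign β p * (β.coframe 0 p v * β.coframe 1 p w
    - β.coframe 1 p v * β.coframe 0 p w)) * h1

lemma transSign_mul (hg : g.IsKossowski) (hα : p ∈ α.chart.source) (hβ : p ∈ β.chart.source)
    (hγ : p ∈ γ.chart.source) :
    α.transSign β p * β.transSign γ p = α.transSign γ p := by
  refine eq_of_eventually_eq_mul (mvfderiv_lam_ne_zero hg hγ) ?_ (eventually_area_eq hg hα hγ)
  filter_upwards [eventually_transSign_eq hg hα hβ, eventually_area_eq hg hβ hγ,
    α.chart.open_source.mem_nhds hα, β.chart.open_source.mem_nhds hβ] with q h1 h2 h3 h4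
  rw [area_eq_transSign_mul hg h3 h4, h1, h2, mul_assoc]

/-- The cocycle condition: the first columns agree by the transformation of the coframes, the second
ones because the signs are multiplicative. -/
lemma trans_mul_trans (hg : g.IsKossowski) (hα : p ∈ α.chart.source) (hβ : p ∈ β.chart.source)
    (hγ : p ∈ γ.chart.source) : α.trans β p * β.trans γ p = α.trans γ p := by
  have h0 := (sqrt_coeffE_pos hγ).ne'
  have hs := transSign_mul hg hα hβ hγ
  have hu (i : Fin 2) : α.trans γ p i 0
      = α.trans β p i 0 * β.trans γ p 0 0 + α.trans β p i 1 * β.trans γ p 1 0 := by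
    have h1 := coframe_eq_sum_trans hg hα hβ i (coordField γ.chart 0 p)
    rw [Fin.sum_univ_two] at h1
    have h2 (δ : g.FrameChart) (k : Fin 2) : δ.coframe k p (coordField γ.chart 0 p)
        = δ.trans γ p k 0 * √(g.coeffE γ.chart p) := by
      fin_cases k <;> simp [trans, h0]
    rw [h2, h2, h2] at h1
    refine mul_right_cancel₀ h0 (h1.trans ?_)
    ring
  have he : α.transSign β p ^ 2 = 1 := localSign_sq
  ext i j
  rw [Matrix.mul_apply, Fin.sum_univ_two]
  fin_cases j
  · exact (hu i).symm
  · have h3 := hu 0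
    have h4 := hu 1
    fin_cases i
    · simp only [Fin.zero_eta, Fin.mk_one, trans_apply_zero_one, trans_apply_one_one, ← hs]
        at h3 h4 ⊢
      rw [h4]
      linear_combination (β.transSign γ p * β.trans γ p 1 0 * α.trans β p 0 0) * he
    · simp only [Fin.mk_one, trans_apply_zero_one, trans_apply_one_one, ← hs] at h3 h4 ⊢
      rw [h3]
      linear_combination (β.transSign γ p * β.trans γ p 1 0 * α.trans β p 1 0) * he

lemma trans_self (hp : p ∈ α.chart.source) : α.trans α p = 1 := by
  have h0 := (sqrt_coeffE_pos hp).ne'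
  have hs : α.transSign α p = 1 := if_pos <| by
    filter_upwards [α.chart.open_source.mem_nhds hp] with q hq
    exact area_coordField_self hq
  have h00 : α.trans α p 0 0 = 1 := by
    simp only [trans, coframe_coordField hp]
    simp [coframeMatrix, h0]
  have h10 : α.trans α p 1 0 = 0 := by
    simp only [trans, coframe_coordField hp]
    simp [coframeMatrix]
  ext i j
  fin_cases i <;> fin_cases j <;> simp [h00, h10, trans_apply_zero_one, trans_apply_one_one, hs]

/-- Off the singular set, the matrix `trans α β` is the transition matrix of the orthonormal
frames. -/
lemma trans_eq_inv_mul (hg : g.IsKossowski) (hα : p ∈ α.chart.source) (hβ : p ∈ β.chart.source)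
    (h : p ∉ g.singularSet) :
    α.trans β p = (α.frameMatrix p)⁻¹ * α.jacobian β p * β.frameMatrix p := by
  have hlα : α.lam p ≠ 0 := fun h0 ↦ h ((isSingular_iff hα).2 h0)
  have hlβ : β.lam p ≠ 0 := fun h0 ↦ h ((isSingular_iff hβ).2 h0)
  have h1 : α.coframeMatrix p * α.jacobian β p = α.trans β p * β.coframeMatrix p := by
    ext i j
    have h2 := coframe_eq_sum_trans hg hα hβ i (coordField β.chart j p)
    simp only [coframe_coordField hβ] at h2
    rw [Matrix.mul_apply, Matrix.mul_apply, ← h2, coframe_apply, Fin.sum_univ_two]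
    rfl
  rw [Matrix.inv_eq_left_inv (coframeMatrix_mul_frameMatrix hα hlα), h1, Matrix.mul_assoc,
    coframeMatrix_mul_frameMatrix hβ hlβ, Matrix.mul_one]

end SemiMetric.FrameChart

/-! ### The Euclidean bundle glued by the transition matrices -/

namespace SemiMetric

variable {M : Type*} [TopologicalSpace M] [ChartedSpace Plane M] [IsManifold (𝓡 2) ∞ M]
  {g : SemiMetric M}

lemma FrameChart.contMDiffAt_toEuclideanCLM_trans (hg : g.IsKossowski) {α β : g.FrameChart} {p : M}
    (hα : p ∈ α.chart.source) (hβ : p ∈ β.chart.source) :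
    ContMDiffAt (𝓡 2) 𝓘(ℝ, Plane →L[ℝ] Plane) ∞
      (fun q ↦ Matrix.toEuclideanCLM (𝕜 := ℝ) (α.trans β q)) p := by
  refine contMDiffAt_clm_of_apply fun w ↦ ?_
  have h : (fun q ↦ Matrix.toEuclideanCLM (𝕜 := ℝ) (α.trans β q) w)
      = fun q ↦ ∑ i, (∑ j, α.trans β q i j * w j) • (EuclideanSpace.single i (1 : ℝ) : Plane) := by
    funext q
    ext k
    fin_cases k <;> simp [Matrix.mulVec, dotProduct, Fin.sum_univ_two]
  rw [h]
  simp only [Fin.sum_univ_two]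
  exact ((((contMDiffAt_trans hg hα hβ 0 0).mul contMDiffAt_const).add
    ((contMDiffAt_trans hg hα hβ 0 1).mul contMDiffAt_const)).smul contMDiffAt_const).add
    ((((contMDiffAt_trans hg hα hβ 1 0).mul contMDiffAt_const).add
    ((contMDiffAt_trans hg hα hβ 1 1).mul contMDiffAt_const)).smul contMDiffAt_const)

/-- The vector bundle glued from the products `U_α × ℝ²` by the matrices `trans`; a vector with
components `x` in the chart `α` has components `trans β α x` in the chart `β`. -/
def frameCore (hg : g.IsKossowski) : VectorBundleCore ℝ M Plane g.FrameChart where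
  baseSet α := α.chart.source
  isOpen_baseSet α := α.chart.open_source
  indexAt p := (hg.exists_frameChart p).choose
  mem_baseSet_at p := (hg.exists_frameChart p).choose_spec
  coordChange α β p := Matrix.toEuclideanCLM (𝕜 := ℝ) (β.trans α p)
  coordChange_self α p hp v := by rw [FrameChart.trans_self hp]; simp
  continuousOn_coordChange α β p hp :=
    (FrameChart.contMDiffAt_toEuclideanCLM_trans hg hp.2 hp.1).continuousAt.continuousWithinAt
  coordChange_comp α β γ p hp v := by
    rw [← FrameChart.trans_mul_trans hg hp.2 hp.1.2 hp.1.1]; simp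

instance (hg : g.IsKossowski) : (frameCore hg).IsContMDiff (𝓡 2) ∞ where
  contMDiffOn_coordChange _ _ _ hp :=
    (FrameChart.contMDiffAt_toEuclideanCLM_trans hg hp.2 hp.1).contMDiffWithinAt

/-- The fibre at `p` of the bundle `frameCore hg`, with the inner product of `ℝ²`: the components of
a vector are those in the frame chart that the bundle assigns to `p`. A separate type is needed
since the fibres of a `VectorBundleCore` carry no norm. -/
def FrameFiber (_hg : g.IsKossowski) (_p : M) : Type := Plane

namespace FrameFiber

variable (hg : g.IsKossowski)

instance (p : M) : NormedAddCommGroup (FrameFiber hg p) :=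
  inferInstanceAs (NormedAddCommGroup Plane)

instance (p : M) : InnerProductSpace ℝ (FrameFiber hg p) :=
  inferInstanceAs (InnerProductSpace ℝ Plane)

instance : TopologicalSpace (TotalSpace Plane (FrameFiber hg)) :=
  inferInstanceAs (TopologicalSpace (TotalSpace Plane (frameCore hg).Fiber))

instance : FiberBundle Plane (FrameFiber hg) :=
  inferInstanceAs (FiberBundle Plane (frameCore hg).Fiber)

instance : VectorBundle ℝ Plane (FrameFiber hg) :=
  inferInstanceAs (VectorBundle ℝ Plane (frameCore hg).Fiber)

instance : ContMDiffVectorBundle ∞ Plane (FrameFiber hg) (𝓡 2) :=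
  inferInstanceAs (ContMDiffVectorBundle ∞ Plane (frameCore hg).Fiber (𝓡 2))

/-- The local trivialization of the bundle over the domain of the frame chart `α`. -/
def localTriv (α : g.FrameChart) : Trivialization Plane (π Plane (FrameFiber hg)) :=
  (frameCore hg).localTriv α

instance (α : g.FrameChart) : MemTrivializationAtlas (localTriv hg α) := ⟨⟨α, rfl⟩⟩

lemma inner_toEuclideanCLM {A : Matrix (Fin 2) (Fin 2) ℝ}
    (hA : A ∈ Matrix.orthogonalGroup (Fin 2) ℝ) (x y : Plane) :
    inner ℝ (Matrix.toEuclideanCLM (𝕜 := ℝ) A x) (Matrix.toEuclideanCLM (𝕜 := ℝ) A y)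
      = inner ℝ x y := by
  have h : star A * A = 1 := (Matrix.mem_orthogonalGroup_iff' _ _).1 hA
  rw [← ContinuousLinearMap.adjoint_inner_right, ← ContinuousLinearMap.star_eq_adjoint, ← map_star,
    ← mul_apply_eq_comp, ← map_mul, h, map_one]
  rfl

instance : IsContMDiffRiemannianBundle (𝓡 2) ∞ Plane (FrameFiber hg) := by
  refine ⟨fun p ↦ innerSL ℝ, fun p ↦ ?_, fun p v w ↦ rfl⟩
  refine contMDiffAt_hom_of_apply (V₁ := FrameFiber hg) (V₂ := fun p ↦ FrameFiber hg p →L[ℝ] ℝ)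
    fun s hs ↦ contMDiffAt_hom_of_apply (V₁ := FrameFiber hg) (V₂ := Bundle.Trivial M ℝ)
    fun t ht ↦ ?_
  rw [contMDiffAt_section]
  let α := (frameCore hg).indexAt p
  have hp : p ∈ α.chart.source := (frameCore hg).mem_baseSet_at p
  have hs' := ((localTriv hg α).contMDiffAt_section_iff hp).1 hs
  have ht' := ((localTriv hg α).contMDiffAt_section_iff hp).1 ht
  -- the change of trivializations is orthogonal, so that it preserves the inner product
  refine ((contDiff_inner (𝕜 := ℝ) (n := ∞)).contMDiff.contMDiffAt.comp p
    (hs'.prodMk_space ht')).congr_of_eventuallyEq ?_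
  filter_upwards [α.chart.open_source.mem_nhds hp] with q hq
  exact (inner_toEuclideanCLM (FrameChart.trans_mem_orthogonalGroup hq
    ((frameCore hg).mem_baseSet_at q)) (s q) (t q)).symm

/-- The orthonormal frame of the bundle over the domain of the frame chart `α`. -/
def frame (α : g.FrameChart) (i : Fin 2) (p : M) : FrameFiber hg p :=
  (frameCore hg).coordChange α ((frameCore hg).indexAt p) p (EuclideanSpace.single i (1 : ℝ))

variable {hg} {α β : g.FrameChart} {p : M}

lemma contMDiffAt_frame (hp : p ∈ α.chart.source) (i : Fin 2) :
    ContMDiffAt (𝓡 2) ((𝓡 2).prod 𝓘(ℝ, Plane)) ∞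
      (fun q ↦ TotalSpace.mk' Plane q (frame hg α i q)) p := by
  rw [(localTriv hg α).contMDiffAt_section_iff hp]
  refine (contMDiffAt_const (c := EuclideanSpace.single i (1 : ℝ))).congr_of_eventuallyEq ?_
  filter_upwards [α.chart.open_source.mem_nhds hp] with q hq
  exact ((frameCore hg).coordChange_comp α _ α q
    ⟨⟨hq, (frameCore hg).mem_baseSet_at q⟩, hq⟩ _).trans
    ((frameCore hg).coordChange_self α q hq _)

lemma orthonormal_frame (hp : p ∈ α.chart.source) : Orthonormal ℝ (fun i ↦ frame hg α i p) := by
  rw [orthonormal_iff_ite]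
  intro i j
  refine (inner_toEuclideanCLM (FrameChart.trans_mem_orthogonalGroup
    ((frameCore hg).mem_baseSet_at p) hp) _ _).trans ?_
  simp [EuclideanSpace.inner_single_left]

lemma frame_eq_sum_trans (hα : p ∈ α.chart.source) (hβ : p ∈ β.chart.source) (j : Fin 2) :
    frame hg β j p = ∑ i, α.trans β p i j • frame hg α i p := by
  refine ((frameCore hg).coordChange_comp β α _ p
    ⟨⟨hβ, hα⟩, (frameCore hg).mem_baseSet_at p⟩ _).symm.trans ?_
  have h : (frameCore hg).coordChange β α p (EuclideanSpace.single j (1 : ℝ))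
      = ∑ i, α.trans β p i j • (EuclideanSpace.single i (1 : ℝ) : Plane) := by
    ext k
    fin_cases k <;> simp [frameCore, Fin.sum_univ_two]
  rw [h, map_sum]
  simp only [map_smul]
  rfl

end FrameFiber

end SemiMetric

/-! ### The connection form of a frame chart -/

section LocalConnectionForm

variable {M : Type*} [TopologicalSpace M] [ChartedSpace Plane M]

lemma mvfderiv_congr_of_eventuallyEq {F : Type*} [NormedAddCommGroup F] [NormedSpace ℝ F]
    {f k : M → F} {p : M} (h : ∀ᶠ q in 𝓝 p, f q = k q) :
    mvfderiv (𝓡 2) f p = mvfderiv (𝓡 2) k p := by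
  rw [mvfderiv, Filter.EventuallyEq.mfderiv_eq h]
  rfl

variable [IsManifold (𝓡 2) ∞ M]

/-- A vector field which is smooth on an open set agrees near each point of it with a globally
smooth one. -/
lemma exists_isSmoothField_eventually_eq [T2Space M] {U : Set M} (hU : IsOpen U) {p : M}
    (hp : p ∈ U) {X : ∀ q : M, TangentSpace (𝓡 2) q}
    (hX : ∀ q ∈ U, ContMDiffAt (𝓡 2) ((𝓡 2).prod (𝓡 2)) ∞
      (fun q ↦ TotalSpace.mk' Plane q (X q)) q) :
    ∃ Y : ∀ q : M, TangentSpace (𝓡 2) q, IsSmoothField Y ∧ ∀ᶠ q in 𝓝 p, Y q = X q := by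
  obtain ⟨φ, -, hφ⟩ := (SmoothBumpFunction.nhds_basis_tsupport (I := 𝓡 2) p).mem_iff.1
    (hU.mem_nhds hp)
  refine ⟨fun q ↦ φ q • X q, fun q ↦ ?_, ?_⟩
  · by_cases hq : q ∈ U
    · exact φ.contMDiffAt.smul_section (hX q hq)
    · have h0 : ∀ᶠ x in 𝓝 q, φ x = 0 := by
        filter_upwards [(isClosed_tsupport φ).isOpen_compl.mem_nhds fun h ↦ hq (hφ h)] with x hx
        exact image_eq_zero_of_notMem_tsupport hx
      refine (contMDiff_zeroSection ℝ (fun q : M ↦ TangentSpace (𝓡 2) q)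
        q).congr_of_eventuallyEq (h0.mono fun x hx ↦ ?_)
      simp only [hx, zero_smul]
      rfl
  · filter_upwards [φ.eventuallyEq_one] with q hq
    simp [hq]

namespace SemiMetric.FrameChart

variable {g : SemiMetric M} {α : g.FrameChart} {p : M}

lemma coframeMatrix_apply_zero_zero_pos (hp : p ∈ α.chart.source) : 0 < α.coframeMatrix p 0 0 :=
  sqrt_coeffE_pos hp

lemma coframeMatrix_apply_one_zero : α.coframeMatrix p 1 0 = 0 := rfl

lemma lam_eq (hp : p ∈ α.chart.source) :
    α.lam p = α.coframeMatrix p 0 0 * α.coframeMatrix p 1 1 :=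
  (mul_div_cancel₀ _ (sqrt_coeffE_pos hp).ne').symm

lemma mdifferentiableAt_coframeMatrix (hp : p ∈ α.chart.source) (i j : Fin 2) :
    MDifferentiableAt (𝓡 2) 𝓘(ℝ) (fun q ↦ α.coframeMatrix q i j) p :=
  (contMDiffAt_coframeMatrix hp i j).mdifferentiableAt (by simp)

/-- At a singular point, admissibility implies that the `1`-form `η₀` is closed. -/
lemma mvfderiv_coframeMatrix_eq [T2Space M] (hg : g.IsKossowski) (hp : p ∈ α.chart.source)
    (h : α.lam p = 0) :
    mvfderiv (𝓡 2) (fun q ↦ α.coframeMatrix q 0 1) p (coordField α.chart 0 p)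
      = mvfderiv (𝓡 2) (fun q ↦ α.coframeMatrix q 0 0) p (coordField α.chart 1 p) := by
  have ha := (coframeMatrix_apply_zero_zero_pos hp).ne'
  have hc : α.coframeMatrix p 1 1 = 0 := by
    simpa [ha, h] using (lam_eq hp).symm
  set a : M → ℝ := fun q ↦ α.coframeMatrix q 0 0 with hadef
  set b : M → ℝ := fun q ↦ α.coframeMatrix q 0 1 with hbdef
  have hda : MDifferentiableAt (𝓡 2) 𝓘(ℝ) a p := mdifferentiableAt_coframeMatrix hp 0 0
  have hdb : MDifferentiableAt (𝓡 2) 𝓘(ℝ) b p := mdifferentiableAt_coframeMatrix hp 0 1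
  have hcoord (i : Fin 2) {q : M} (hq : q ∈ α.chart.source) :=
    contMDiffAt_coordField α.mem_maximalAtlas i hq
  -- near `p`, the field `Z` has constant coefficients, and its value at `p` is null
  let Z₀ (q : M) : TangentSpace (𝓡 2) q :=
    a p • coordField α.chart 1 q + (-b p) • coordField α.chart 0 q
  obtain ⟨X, hX, hX0⟩ := exists_isSmoothField_eventually_eq α.chart.open_source hp
    fun q hq ↦ hcoord 0 hq
  obtain ⟨Z, hZ, hZ0⟩ := exists_isSmoothField_eventually_eq (X := Z₀) α.chart.open_source hp
    fun q hq ↦ ((contMDiffAt_const (c := a p)).smul_section (hcoord 1 hq)).add_section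
      ((contMDiffAt_const (c := -b p)).smul_section (hcoord 0 hq))
  have hXp := hX0.self_of_nhds
  have hZp := hZ0.self_of_nhds
  have hnull : g.IsNull p (Z p) := fun w ↦ by
    rw [form_eq_sum_coframe hp, hZp]
    simp only [Z₀, map_add, map_smul, coframe_coordField hp, smul_eq_mul, hc,
      coframeMatrix_apply_one_zero, hadef, hbdef]
    ring
  -- admissibility at `p` reads `∂_u⟨∂_u, Z⟩ = ½ Z⟨∂_u, ∂_u⟩`, the brackets being zero
  have hadm := hg.1.1 p ((isSingular_iff hp).2 h) X X Z hX hX hZ hnull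
  have hbr : VectorField.mlieBracket (𝓡 2) X Z p = 0 := by
    have hd (i : Fin 2) := (hcoord i hp).mdifferentiableAt (by simp)
    rw [Filter.EventuallyEq.mlieBracket_vectorField_eq hX0 hZ0]
    refine (VectorField.mlieBracket_add_right (V := coordField α.chart 0)
      (W := a p • coordField α.chart 1) (W₁ := (-b p) • coordField α.chart 0)
      ((mdifferentiableAt_const (c := a p)).smul_section (hd 1))
      ((mdifferentiableAt_const (c := -b p)).smul_section (hd 0))).trans ?_
    rw [VectorField.mlieBracket_const_smul_right (hd 1),
      VectorField.mlieBracket_const_smul_right (hd 0),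
      mlieBracket_coordField α.mem_maximalAtlas 0 1 hp,
      mlieBracket_coordField α.mem_maximalAtlas 0 0 hp]
    simp
  have hXX : (fun q ↦ g.form q (X q) (X q)) =ᶠ[𝓝 p] fun q ↦ a q * a q := by
    filter_upwards [hX0, α.chart.open_source.mem_nhds hp] with q h1 hq
    rw [h1, form_eq_sum_coframe hq, coframe_coordField hq, coframe_coordField hq,
      coframeMatrix_apply_one_zero]
    ring
  have hXZ : (fun q ↦ g.form q (X q) (Z q)) =ᶠ[𝓝 p]
      fun q ↦ a p * (a q * b q) + (-b p) * (a q * a q) := by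
    filter_upwards [hX0, hZ0, α.chart.open_source.mem_nhds hp] with q h1 h2 hq
    rw [h1, h2, form_eq_sum_coframe hq]
    simp only [Z₀, map_add, map_smul, coframe_coordField hq, smul_eq_mul,
      coframeMatrix_apply_one_zero, hadef, hbdef]
    ring
  have hself : VectorField.mlieBracket (𝓡 2) X X p = 0 := by simp
  have hab : MDifferentiableAt (𝓡 2) 𝓘(ℝ) (fun q ↦ a q * b q) p := hda.mul hdb
  have haa : MDifferentiableAt (𝓡 2) 𝓘(ℝ) (fun q ↦ a q * a q) p := hda.mul hda
  have hdc (c : ℝ) : MDifferentiableAt (𝓡 2) 𝓘(ℝ) (fun _ : M ↦ c) p := mdifferentiableAt_const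
  have hd1 : mvfderiv (𝓡 2) (fun q ↦ a p * (a q * b q) + (-b p) * (a q * a q)) p
      = a p • mvfderiv (𝓡 2) (fun q ↦ a q * b q) p
        + (-b p) • mvfderiv (𝓡 2) (fun q ↦ a q * a q) p := by
    rw [mvfderiv_fun_add (g := fun q ↦ a p * (a q * b q)) (g' := fun q ↦ (-b p) * (a q * a q))
      ((hdc _).mul hab) ((hdc _).mul haa), mvfderiv_fun_mul (hdc _) hab,
      mvfderiv_fun_mul (hdc _) haa, mvfderiv_const, mvfderiv_const, smul_zero, smul_zero, add_zero,
      add_zero]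
  rw [pseudoConnection, hbr, hself, mvfderiv_congr_of_eventuallyEq hXX,
    mvfderiv_congr_of_eventuallyEq hXZ, hXp, hZp, hd1, mvfderiv_fun_mul hda hdb,
    mvfderiv_fun_mul hda hda] at hadm
  simp only [Z₀, map_add, map_smul, map_zero, _root_.add_apply,
    _root_.smul_apply, _root_.zero_apply, smul_eq_mul] at hadm
  refine mul_left_cancel₀ (mul_ne_zero ha ha) ?_
  simp only [hadef, hbdef] at hadm ⊢
  linear_combination hadm

/-- There is a smooth `1`-form `θ` with `dη₀ = η₁ ∧ θ` and `dη₁ = θ ∧ η₀`; these equations are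
stated for their values on `(∂_u, ∂_v)`. Off the singular set they determine `θ`; it extends since
`dη₀(∂_u, ∂_v)`, which vanishes at the singular points, is divisible by `lam`. -/
lemma exists_connectionForm [T2Space M] (hg : g.IsKossowski) (α : g.FrameChart) :
    ∃ θ : ∀ p : M, TangentSpace (𝓡 2) p →L[ℝ] ℝ,
      (∀ p ∈ α.chart.source, ContMDiffAt (𝓡 2) ((𝓡 2).prod 𝓘(ℝ, Plane →L[ℝ] ℝ)) ∞
        (fun p ↦ TotalSpace.mk' (Plane →L[ℝ] ℝ)
          (E := fun p : M ↦ TangentSpace (𝓡 2) p →L[ℝ] ℝ) p (θ p)) p) ∧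
      ∀ p ∈ α.chart.source,
        α.coframeMatrix p 1 1 * θ p (coordField α.chart 0 p)
          = mvfderiv (𝓡 2) (fun q ↦ α.coframeMatrix q 0 0) p (coordField α.chart 1 p)
            - mvfderiv (𝓡 2) (fun q ↦ α.coframeMatrix q 0 1) p (coordField α.chart 0 p) ∧
        α.coframeMatrix p 0 0 * θ p (coordField α.chart 1 p)
          = α.coframeMatrix p 0 1 * θ p (coordField α.chart 0 p)
            - mvfderiv (𝓡 2) (fun q ↦ α.coframeMatrix q 1 1) p (coordField α.chart 0 p) := by
  have hD (i j k : Fin 2) {p : M} (hp : p ∈ α.chart.source) :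
      ContMDiffAt (𝓡 2) 𝓘(ℝ) ∞ (fun q ↦ mvfderiv (𝓡 2) (fun q ↦ α.coframeMatrix q i j) q
        (coordField α.chart k q)) p :=
    contMDiffAt_mvfderiv_apply (contMDiffAt_coframeMatrix hp i j)
      (contMDiffAt_coordField α.mem_maximalAtlas k hp)
  obtain ⟨k, hk, hk'⟩ := exists_contMDiffOn_eq_mul α.mem_maximalAtlas (l := α.lam)
    (f := fun p ↦ α.coframeMatrix p 0 0 *
      (mvfderiv (𝓡 2) (fun q ↦ α.coframeMatrix q 0 0) p (coordField α.chart 1 p)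
        - mvfderiv (𝓡 2) (fun q ↦ α.coframeMatrix q 0 1) p (coordField α.chart 0 p)))
    (fun p hp ↦ ((contMDiffAt_coframeMatrix hp 0 0).mul
      ((hD 0 0 1 hp).sub (hD 0 1 0 hp))).contMDiffWithinAt) α.isAreaDensityOn.1
    (fun p hp h ↦ by rw [mvfderiv_coframeMatrix_eq hg hp h]; ring)
    fun p hp ↦ mvfderiv_lam_ne_zero hg hp
  let c : M → ℝ := fun p ↦ (α.coframeMatrix p 0 1 * k p
    - mvfderiv (𝓡 2) (fun q ↦ α.coframeMatrix q 1 1) p (coordField α.chart 0 p))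
      / α.coframeMatrix p 0 0
  let du (i : Fin 2) (p : M) : TangentSpace (𝓡 2) p →L[ℝ] ℝ :=
    (EuclideanSpace.proj i : Plane →L[ℝ] ℝ).comp (mvfderiv (𝓡 2) α.chart p)
  have hdu {p : M} (hp : p ∈ α.chart.source) (i j : Fin 2) :
      du i p (coordField α.chart j p) = if i = j then 1 else 0 := by
    simp [du, mvfderiv_coordField α.mem_maximalAtlas j hp]
  refine ⟨fun p ↦ k p • du 0 p + c p • du 1 p, fun p hp ↦ ?_, fun p hp ↦ ⟨?_, ?_⟩⟩
  · refine contMDiffAt_hom_of_apply (V₂ := Bundle.Trivial M ℝ) fun X hX ↦ ?_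
    rw [contMDiffAt_section]
    have hX' (i : Fin 2) : ContMDiffAt (𝓡 2) 𝓘(ℝ) ∞ (fun q ↦ du i q (X q)) p :=
      (EuclideanSpace.proj i : Plane →L[ℝ] ℝ).contMDiff.contMDiffAt.comp p
        (contMDiffAt_mvfderiv_apply (contMDiffAt_of_mem_maximalAtlas α.mem_maximalAtlas hp) hX)
    have hk0 : ContMDiffAt (𝓡 2) 𝓘(ℝ) ∞ k p := hk.contMDiffAt (α.chart.open_source.mem_nhds hp)
    have hc : ContMDiffAt (𝓡 2) 𝓘(ℝ) ∞ c p :=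
      (((contMDiffAt_coframeMatrix hp 0 1).mul hk0).sub (hD 1 1 0 hp)).div₀
        (contMDiffAt_coframeMatrix hp 0 0) (coframeMatrix_apply_zero_zero_pos hp).ne'
    exact (hk0.mul (hX' 0)).add (hc.mul (hX' 1))
  · have h1 := hk' p hp
    rw [lam_eq hp, mul_assoc] at h1
    simp [hdu hp, mul_left_cancel₀ (coframeMatrix_apply_zero_zero_pos hp).ne' h1]
  · simp [hdu hp, c, mul_div_cancel₀ _ (coframeMatrix_apply_zero_zero_pos hp).ne']

/-- The connection form of a frame chart, which is smooth across the singular set; it is arbitrary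
outside the domain of the chart. -/
def connectionForm [T2Space M] (hg : g.IsKossowski) (α : g.FrameChart) :
    ∀ p : M, TangentSpace (𝓡 2) p →L[ℝ] ℝ := (exists_connectionForm hg α).choose

section ConnectionForm

variable [T2Space M] {hg : g.IsKossowski}

lemma contMDiffAt_connectionForm (hp : p ∈ α.chart.source) :
    ContMDiffAt (𝓡 2) ((𝓡 2).prod 𝓘(ℝ, Plane →L[ℝ] ℝ)) ∞
      (fun p ↦ TotalSpace.mk' (Plane →L[ℝ] ℝ)
        (E := fun p : M ↦ TangentSpace (𝓡 2) p →L[ℝ] ℝ) p (α.connectionForm hg p)) p :=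
  (exists_connectionForm hg α).choose_spec.1 p hp

lemma contMDiffAt_connectionForm_apply (hp : p ∈ α.chart.source)
    {X : ∀ p : M, TangentSpace (𝓡 2) p}
    (hX : ContMDiffAt (𝓡 2) ((𝓡 2).prod (𝓡 2)) ∞ (fun q ↦ TotalSpace.mk' Plane q (X q)) p) :
    ContMDiffAt (𝓡 2) 𝓘(ℝ) ∞ (fun q ↦ α.connectionForm hg q (X q)) p := by
  have h := ContMDiffAt.clm_bundle_apply (F₁ := Plane) (F₂ := ℝ) (E₂ := Bundle.Trivial M ℝ)
    (contMDiffAt_connectionForm (hg := hg) hp) hX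
  rw [contMDiffAt_section] at h
  exact h

lemma mul_connectionForm_coordField_zero (hp : p ∈ α.chart.source) :
    α.coframeMatrix p 1 1 * α.connectionForm hg p (coordField α.chart 0 p)
      = mvfderiv (𝓡 2) (fun q ↦ α.coframeMatrix q 0 0) p (coordField α.chart 1 p)
        - mvfderiv (𝓡 2) (fun q ↦ α.coframeMatrix q 0 1) p (coordField α.chart 0 p) :=
  ((exists_connectionForm hg α).choose_spec.2 p hp).1

lemma mul_connectionForm_coordField_one (hp : p ∈ α.chart.source) :
    α.coframeMatrix p 0 0 * α.connectionForm hg p (coordField α.chart 1 p)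
      = α.coframeMatrix p 0 1 * α.connectionForm hg p (coordField α.chart 0 p)
        - mvfderiv (𝓡 2) (fun q ↦ α.coframeMatrix q 1 1) p (coordField α.chart 0 p) :=
  ((exists_connectionForm hg α).choose_spec.2 p hp).2

end ConnectionForm

end SemiMetric.FrameChart

end LocalConnectionForm

/-! ### The bundle homomorphism and the local connections -/

namespace SemiMetric.FrameFiber

open FrameChart

variable {M : Type*} [TopologicalSpace M] [ChartedSpace Plane M] [IsManifold (𝓡 2) ∞ M]
  {g : SemiMetric M} (hg : g.IsKossowski)

/-- The bundle homomorphism `ψ`: the tangent vector with components `η₀, η₁` in the coframe of a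
frame chart is mapped to the vector with the same components in the frame of the bundle. -/
def hom (p : M) : TangentSpace (𝓡 2) p →L[ℝ] FrameFiber hg p :=
  ∑ i, (((frameCore hg).indexAt p).coframe i p).smulRight (frame hg ((frameCore hg).indexAt p) i p)

variable {hg} {α β : g.FrameChart} {p : M}

lemma hom_eq_sum_coframe (hp : p ∈ α.chart.source) (v : TangentSpace (𝓡 2) p) :
    hom hg p v = ∑ i, α.coframe i p v • frame hg α i p := by
  have hι := (frameCore hg).mem_baseSet_at p
  simp only [hom, Fin.sum_univ_two, _root_.add_apply, ContinuousLinearMap.smulRight_apply,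
    frame_eq_sum_trans hp hι, coframe_eq_sum_trans hg hp hι]
  module

lemma contMDiffAt_hom_apply {X : ∀ p : M, TangentSpace (𝓡 2) p}
    (hX : ContMDiffAt (𝓡 2) ((𝓡 2).prod (𝓡 2)) ∞ (fun q ↦ TotalSpace.mk' Plane q (X q)) p) :
    ContMDiffAt (𝓡 2) ((𝓡 2).prod 𝓘(ℝ, Plane)) ∞
      (fun q ↦ TotalSpace.mk' Plane q (hom hg q (X q))) p := by
  obtain ⟨α, hp⟩ := hg.exists_frameChart p
  refine (((contMDiffAt_coframe_apply hp 0 hX).smul_section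
    (contMDiffAt_frame (hg := hg) hp 0)).add_section
    ((contMDiffAt_coframe_apply hp 1 hX).smul_section
      (contMDiffAt_frame (hg := hg) hp 1))).congr_of_eventuallyEq ?_
  filter_upwards [α.chart.open_source.mem_nhds hp] with q hq
  rw [hom_eq_sum_coframe hq, Fin.sum_univ_two]
  rfl

lemma contMDiff_hom : ContMDiff (𝓡 2) ((𝓡 2).prod 𝓘(ℝ, Plane →L[ℝ] Plane)) ∞
    (fun p ↦ TotalSpace.mk' (Plane →L[ℝ] Plane)
      (E := fun q ↦ TangentSpace (𝓡 2) q →L[ℝ] FrameFiber hg q) p (hom hg p)) :=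
  fun _ ↦ contMDiffAt_hom_of_apply fun _ hX ↦ contMDiffAt_hom_apply hX

lemma eq_sum_inner_frame (hp : p ∈ α.chart.source) (x : FrameFiber hg p) :
    x = inner ℝ (frame hg α 0 p) x • frame hg α 0 p
      + inner ℝ (frame hg α 1 p) x • frame hg α 1 p := by
  have hc : Fintype.card (Fin 2) = Module.finrank ℝ (FrameFiber hg p) :=
    (finrank_euclideanSpace (𝕜 := ℝ)).symm
  have : FiniteDimensional ℝ (FrameFiber hg p) := inferInstanceAs (FiniteDimensional ℝ Plane)
  let b := basisOfOrthonormalOfCardEqFinrank (orthonormal_frame (hg := hg) hp) hc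
  have hb : ⇑b = fun i ↦ frame hg α i p := coe_basisOfOrthonormalOfCardEqFinrank _ _
  let o := b.toOrthonormalBasis (hb ▸ orthonormal_frame (hg := hg) hp)
  have ho (i : Fin 2) : o i = frame hg α i p := by simp [o, hb]
  have := (o.sum_repr' x).symm
  simpa [Fin.sum_univ_two, ho] using this

lemma inner_frame_self (hp : p ∈ α.chart.source) (i j : Fin 2) :
    inner ℝ (frame hg α i p) (frame hg α j p) = if i = j then (1 : ℝ) else 0 :=
  orthonormal_iff_ite.1 (orthonormal_frame hp) i j

lemma inner_frame_hom (hp : p ∈ α.chart.source) (i : Fin 2) (v : TangentSpace (𝓡 2) p) :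
    inner ℝ (frame hg α i p) (hom hg p v) = α.coframe i p v := by
  rw [hom_eq_sum_coframe hp, Fin.sum_univ_two, inner_add_right, inner_smul_right, inner_smul_right,
    inner_frame_self hp, inner_frame_self hp]
  fin_cases i <;> simp

lemma inner_eq_sum_frame (hp : p ∈ α.chart.source) (x y : FrameFiber hg p) :
    inner ℝ x y = inner ℝ (frame hg α 0 p) x * inner ℝ (frame hg α 0 p) y
      + inner ℝ (frame hg α 1 p) x * inner ℝ (frame hg α 1 p) y := by
  conv_lhs => rw [eq_sum_inner_frame hp x]
  rw [inner_add_left, real_inner_smul_left, real_inner_smul_left]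

lemma inner_hom_hom (v w : TangentSpace (𝓡 2) p) :
    inner ℝ (hom hg p v) (hom hg p w) = g.form p v w := by
  obtain ⟨α, hp⟩ := hg.exists_frameChart p
  rw [inner_eq_sum_frame hp]
  simp only [inner_frame_hom hp, form_eq_sum_coframe hp]

/-- Differentiability of a section of the glued bundle at a point. -/
def SectionDifferentiableAt (s : ∀ p : M, FrameFiber hg p) (p : M) : Prop :=
  MDifferentiableAt (𝓡 2) ((𝓡 2).prod 𝓘(ℝ, Plane)) (fun q ↦ TotalSpace.mk' Plane q (s q)) p

lemma sectionDifferentiableAt_frame (hp : p ∈ α.chart.source) (i : Fin 2) :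
    SectionDifferentiableAt (frame hg α i) p :=
  (contMDiffAt_frame hp i).mdifferentiableAt (by simp)

lemma mdifferentiableAt_inner {s t : ∀ p : M, FrameFiber hg p} (hs : SectionDifferentiableAt s p)
    (ht : SectionDifferentiableAt t p) :
    MDifferentiableAt (𝓡 2) 𝓘(ℝ) (fun q ↦ inner ℝ (s q) (t q)) p :=
  MDifferentiableAt.inner_bundle hs ht

variable [T2Space M]

variable (hg α) in
/-- The metric connection on the domain of `α` with `D ê₀ = -θ ê₁` and `D ê₁ = θ ê₀`, where
`(ê₀, ê₁)` is the frame of the bundle and `θ` the connection form. -/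
def localConn (s : ∀ p : M, FrameFiber hg p) (p : M) : TangentSpace (𝓡 2) p →L[ℝ] FrameFiber hg p :=
  (mvfderiv (𝓡 2) (fun q ↦ inner ℝ (frame hg α 0 q) (s q)) p
      + inner ℝ (frame hg α 1 p) (s p) • α.connectionForm hg p).smulRight (frame hg α 0 p)
    + (mvfderiv (𝓡 2) (fun q ↦ inner ℝ (frame hg α 1 q) (s q)) p
      - inner ℝ (frame hg α 0 p) (s p) • α.connectionForm hg p).smulRight (frame hg α 1 p)

lemma localConn_apply (s : ∀ p : M, FrameFiber hg p) (v : TangentSpace (𝓡 2) p) :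
    localConn hg α s p v = (mvfderiv (𝓡 2) (fun q ↦ inner ℝ (frame hg α 0 q) (s q)) p v
      + inner ℝ (frame hg α 1 p) (s p) * α.connectionForm hg p v) • frame hg α 0 p
    + (mvfderiv (𝓡 2) (fun q ↦ inner ℝ (frame hg α 1 q) (s q)) p v
      - inner ℝ (frame hg α 0 p) (s p) * α.connectionForm hg p v) • frame hg α 1 p := rfl

lemma isCovariantDerivativeOn_localConn :
    IsCovariantDerivativeOn Plane (localConn hg α) α.chart.source where
  add {s t p} hs ht hp := by
    have h (i : Fin 2) : mvfderiv (𝓡 2) (fun q ↦ inner ℝ (frame hg α i q) ((s + t) q)) p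
        = mvfderiv (𝓡 2) (fun q ↦ inner ℝ (frame hg α i q) (s q)) p
          + mvfderiv (𝓡 2) (fun q ↦ inner ℝ (frame hg α i q) (t q)) p := by
      simp only [Pi.add_apply, inner_add_right]
      exact mvfderiv_fun_add (mdifferentiableAt_inner (sectionDifferentiableAt_frame hp i) hs)
        (mdifferentiableAt_inner (sectionDifferentiableAt_frame hp i) ht)
    ext v
    rw [localConn_apply, h, h]
    simp only [localConn_apply, Pi.add_apply, inner_add_right, _root_.add_apply]
    module
  leibniz {s f p} hs hf hp := by
    have h (i : Fin 2) : mvfderiv (𝓡 2) (fun q ↦ inner ℝ (frame hg α i q) ((f • s) q)) p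
        = f p • mvfderiv (𝓡 2) (fun q ↦ inner ℝ (frame hg α i q) (s q)) p
          + (inner ℝ (frame hg α i p) (s p)) • mvfderiv (𝓡 2) f p := by
      simp only [Pi.smul_apply', inner_smul_right]
      exact mvfderiv_fun_mul hf (mdifferentiableAt_inner (sectionDifferentiableAt_frame hp i) hs)
    ext v
    rw [localConn_apply, h, h]
    simp only [localConn_apply, Pi.smul_apply', inner_smul_right, _root_.add_apply,
      _root_.smul_apply, ContinuousLinearMap.smulRight_apply, smul_eq_mul]
    conv_rhs =>
      enter [2, 2]
      rw [eq_sum_inner_frame hp (s p)]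
    module

/-- The local connection is metric. -/
lemma mvfderiv_inner_eq {s t : ∀ p : M, FrameFiber hg p} (hp : p ∈ α.chart.source)
    (hs : SectionDifferentiableAt s p) (ht : SectionDifferentiableAt t p)
    (v : TangentSpace (𝓡 2) p) :
    mvfderiv (𝓡 2) (fun q ↦ inner ℝ (s q) (t q)) p v
      = inner ℝ (localConn hg α s p v) (t p) + inner ℝ (s p) (localConn hg α t p v) := by
  have hc {s : ∀ p : M, FrameFiber hg p} (hs : SectionDifferentiableAt s p) (i : Fin 2) :=
    mdifferentiableAt_inner (sectionDifferentiableAt_frame hp i) hs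
  rw [mvfderiv_congr_of_eventuallyEq (Filter.eventually_of_mem
    (α.chart.open_source.mem_nhds hp) fun q hq ↦ inner_eq_sum_frame hq (s q) (t q))]
  have h0 : MDifferentiableAt (𝓡 2) 𝓘(ℝ) (fun q ↦ inner ℝ (frame hg α 0 q) (s q)
    * inner ℝ (frame hg α 0 q) (t q)) p := (hc hs 0).mul (hc ht 0)
  have h1 : MDifferentiableAt (𝓡 2) 𝓘(ℝ) (fun q ↦ inner ℝ (frame hg α 1 q) (s q)
    * inner ℝ (frame hg α 1 q) (t q)) p := (hc hs 1).mul (hc ht 1)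
  rw [mvfderiv_fun_add h0 h1, mvfderiv_fun_mul (hc hs 0) (hc ht 0),
    mvfderiv_fun_mul (hc hs 1) (hc ht 1)]
  simp only [localConn_apply, inner_add_left, inner_add_right, inner_smul_left, inner_smul_right,
    _root_.add_apply, _root_.smul_apply, real_inner_comm (frame hg α _ p) (s p), smul_eq_mul,
    RCLike.conj_to_real]
  ring

lemma localConn_frame_zero (hp : p ∈ α.chart.source) (v : TangentSpace (𝓡 2) p) :
    localConn hg α (frame hg α 0) p v = -α.connectionForm hg p v • frame hg α 1 p := by
  have h (i j : Fin 2) := mvfderiv_congr_of_eventuallyEq (Filter.eventually_of_mem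
    (α.chart.open_source.mem_nhds hp) fun q hq ↦ inner_frame_self (hg := hg) hq i j)
  rw [localConn_apply, h, h, mvfderiv_const, mvfderiv_const, inner_frame_self hp,
    inner_frame_self hp]
  simp

lemma localConn_frame_one (hp : p ∈ α.chart.source) (v : TangentSpace (𝓡 2) p) :
    localConn hg α (frame hg α 1) p v = α.connectionForm hg p v • frame hg α 0 p := by
  have h (i j : Fin 2) := mvfderiv_congr_of_eventuallyEq (Filter.eventually_of_mem
    (α.chart.open_source.mem_nhds hp) fun q hq ↦ inner_frame_self (hg := hg) hq i j)
  rw [localConn_apply, h, h, mvfderiv_const, mvfderiv_const, inner_frame_self hp,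
    inner_frame_self hp]
  simp

lemma contMDiffAt_localConn_apply {s : ∀ p : M, FrameFiber hg p}
    {X : ∀ p : M, TangentSpace (𝓡 2) p} (hp : p ∈ α.chart.source)
    (hs : ContMDiffAt (𝓡 2) ((𝓡 2).prod 𝓘(ℝ, Plane)) ∞ (fun q ↦ TotalSpace.mk' Plane q (s q)) p)
    (hX : ContMDiffAt (𝓡 2) ((𝓡 2).prod (𝓡 2)) ∞ (fun q ↦ TotalSpace.mk' Plane q (X q)) p) :
    ContMDiffAt (𝓡 2) ((𝓡 2).prod 𝓘(ℝ, Plane)) ∞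
      (fun q ↦ TotalSpace.mk' Plane q (localConn hg α s q (X q))) p := by
  have h (i : Fin 2) : ContMDiffAt (𝓡 2) 𝓘(ℝ) ∞ (fun q ↦ inner ℝ (frame hg α i q) (s q)) p :=
    (contMDiffAt_frame hp i).inner_bundle hs
  have hθ := contMDiffAt_connectionForm_apply (hg := hg) hp hX
  exact ((((contMDiffAt_mvfderiv_apply (h 0) hX).add ((h 1).mul hθ)).smul_section
    (contMDiffAt_frame hp 0)).add_section
    (((contMDiffAt_mvfderiv_apply (h 1) hX).sub ((h 0).mul hθ)).smul_section
      (contMDiffAt_frame hp 1)))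

end SemiMetric.FrameFiber

/-! ### The exterior derivative of the coframe -/

namespace SemiMetric.FrameFiber

open FrameChart

variable {M : Type*} [TopologicalSpace M] [ChartedSpace Plane M] [IsManifold (𝓡 2) ∞ M]
  {g : SemiMetric M} {hg : g.IsKossowski} {α β : g.FrameChart} {p : M}

lemma mdifferentiableAt_coframe_apply (hp : p ∈ α.chart.source) (i : Fin 2)
    {X : ∀ p : M, TangentSpace (𝓡 2) p} (hX : FieldDifferentiableAt X p) :
    MDifferentiableAt (𝓡 2) 𝓘(ℝ) (fun q ↦ α.coframe i q (X q)) p := by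
  have h : ContMDiffAt (𝓡 2) ((𝓡 2).prod 𝓘(ℝ, Plane →L[ℝ] ℝ)) ∞
      (fun p ↦ TotalSpace.mk' (Plane →L[ℝ] ℝ)
        (E := fun p : M ↦ TangentSpace (𝓡 2) p →L[ℝ] Bundle.Trivial M ℝ p) p (α.coframe i p)) p :=
    contMDiffAt_hom_of_apply fun s hs ↦ by
      rw [contMDiffAt_section]
      exact contMDiffAt_coframe_apply hp i hs
  have h2 := (h.mdifferentiableAt (by simp)).clm_bundle_apply hX
  simp only [mdifferentiableAt_totalSpace] at h2
  exact h2.2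

/-- The exterior derivative of the coframe, by the invariant formula
`dη(X, Y) = X η(Y) - Y η(X) - η([X, Y])`. -/
lemma mvfderiv_coframe_sub (hp : p ∈ α.chart.source) (i : Fin 2)
    {X Y : ∀ p : M, TangentSpace (𝓡 2) p} (hX : FieldDifferentiableAt X p)
    (hY : FieldDifferentiableAt Y p) :
    letI x := (mvfderiv (𝓡 2) α.chart p (X p) : Plane)
    letI y := (mvfderiv (𝓡 2) α.chart p (Y p) : Plane)
    mvfderiv (𝓡 2) (fun q ↦ α.coframe i q (Y q)) p (X p)
        - mvfderiv (𝓡 2) (fun q ↦ α.coframe i q (X q)) p (Y p)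
        - α.coframe i p (VectorField.mlieBracket (𝓡 2) X Y p)
      = (x 0 * y 1 - x 1 * y 0) *
        (mvfderiv (𝓡 2) (fun q ↦ α.coframeMatrix q i 1) p (coordField α.chart 0 p)
          - mvfderiv (𝓡 2) (fun q ↦ α.coframeMatrix q i 0) p (coordField α.chart 1 p)) := by
  -- the left-hand side is tensorial, so that it suffices to evaluate it on coordinate fields
  let Φ (X Y : ∀ p : M, TangentSpace (𝓡 2) p) : ℝ :=
    mvfderiv (𝓡 2) (fun q ↦ α.coframe i q (Y q)) p (X p)
        - mvfderiv (𝓡 2) (fun q ↦ α.coframe i q (X q)) p (Y p)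
        - α.coframe i p (VectorField.mlieBracket (𝓡 2) X Y p)
  have hadd {X Y : ∀ p : M, TangentSpace (𝓡 2) p} (hX : FieldDifferentiableAt X p)
      (hY : FieldDifferentiableAt Y p) :
      mvfderiv (𝓡 2) (fun q ↦ α.coframe i q ((X + Y) q)) p
        = mvfderiv (𝓡 2) (fun q ↦ α.coframe i q (X q)) p
          + mvfderiv (𝓡 2) (fun q ↦ α.coframe i q (Y q)) p := by
    simp only [Pi.add_apply, map_add]
    exact mvfderiv_fun_add (mdifferentiableAt_coframe_apply hp i hX)
      (mdifferentiableAt_coframe_apply hp i hY)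
  have hsmul {f : M → ℝ} {X : ∀ p : M, TangentSpace (𝓡 2) p}
      (hf : MDifferentiableAt (𝓡 2) 𝓘(ℝ) f p) (hX : FieldDifferentiableAt X p) :
      mvfderiv (𝓡 2) (fun q ↦ α.coframe i q ((f • X) q)) p
        = f p • mvfderiv (𝓡 2) (fun q ↦ α.coframe i q (X q)) p
          + α.coframe i p (X p) • mvfderiv (𝓡 2) f p := by
    simp only [Pi.smul_apply', map_smul, smul_eq_mul]
    exact mvfderiv_fun_mul hf (mdifferentiableAt_coframe_apply hp i hX)
  have h1 (Y) (hY : FieldDifferentiableAt Y p) : TensorialAt (𝓡 2) Plane (Φ · Y) p := by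
    refine ⟨fun {f X} hf hX ↦ ?_, fun {X X'} hX hX' ↦ ?_⟩
    · simp only [Φ]
      rw [hsmul hf hX, VectorField.mlieBracket_smul_left hf hX]
      simp only [Pi.smul_apply', map_add, map_smul, _root_.add_apply, _root_.smul_apply,
        smul_eq_mul]
      ring
    · simp only [Φ]
      rw [hadd hX hX', VectorField.mlieBracket_add_left hX hX']
      simp only [Pi.add_apply, map_add, _root_.add_apply]
      ring
  have h2 (X) (hX : FieldDifferentiableAt X p) : TensorialAt (𝓡 2) Plane (Φ X ·) p := by
    refine ⟨fun {f Y} hf hY ↦ ?_, fun {Y Y'} hY hY' ↦ ?_⟩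
    · simp only [Φ]
      rw [hsmul hf hY, VectorField.mlieBracket_smul_right hf hY]
      simp only [Pi.smul_apply', map_add, map_smul, _root_.add_apply, _root_.smul_apply,
        smul_eq_mul]
      ring
    · simp only [Φ]
      rw [hadd hY hY', VectorField.mlieBracket_add_right hY hY']
      simp only [Pi.add_apply, map_add, _root_.add_apply]
      ring
  let B := TensorialAt.mkHom₂ Φ p h1 h2
  have hB {X Y : ∀ p : M, TangentSpace (𝓡 2) p} (hX : FieldDifferentiableAt X p)
      (hY : FieldDifferentiableAt Y p) : B (X p) (Y p) = Φ X Y :=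
    TensorialAt.mkHom₂_apply _ _ hX hY
  have hd (j : Fin 2) : FieldDifferentiableAt (coordField α.chart j) p :=
    (contMDiffAt_coordField α.mem_maximalAtlas j hp).mdifferentiableAt (by simp)
  have hc (j k : Fin 2) : B (coordField α.chart j p) (coordField α.chart k p)
      = mvfderiv (𝓡 2) (fun q ↦ α.coframeMatrix q i k) p (coordField α.chart j p)
        - mvfderiv (𝓡 2) (fun q ↦ α.coframeMatrix q i j) p (coordField α.chart k p) := by
    have h3 (k : Fin 2) := mvfderiv_congr_of_eventuallyEq (Filter.eventually_of_mem
      (α.chart.open_source.mem_nhds hp) fun q hq ↦ coframe_coordField hq i k)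
    rw [hB (hd j) (hd k)]
    simp only [Φ]
    rw [h3, h3, mlieBracket_coordField α.mem_maximalAtlas j k hp, map_zero, sub_zero]
  refine (hB hX hY).symm.trans ?_
  rw [eq_sum_coordField α.mem_maximalAtlas hp (X p), eq_sum_coordField α.mem_maximalAtlas hp (Y p)]
  simp only [Fin.sum_univ_two, map_add, map_smul, _root_.add_apply, _root_.smul_apply, hc,
    mvfderiv_coordField α.mem_maximalAtlas _ hp, smul_eq_mul, PiLp.add_apply, PiLp.smul_apply]
  simp
  ring

end SemiMetric.FrameFiber

/-! ### The global connection -/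

namespace SemiMetric.FrameFiber

open FrameChart

variable {M : Type*} [TopologicalSpace M] [T2Space M] [ChartedSpace Plane M]
  [IsManifold (𝓡 2) ∞ M] {g : SemiMetric M} {hg : g.IsKossowski} {α β : g.FrameChart} {p : M}

/-- The local connection is torsion-free, by the structure equations for the connection form. -/
lemma localConn_hom_sub {X Y : ∀ p : M, TangentSpace (𝓡 2) p} (hp : p ∈ α.chart.source)
    (hX : FieldDifferentiableAt X p) (hY : FieldDifferentiableAt Y p) :
    localConn hg α (fun q ↦ hom hg q (Y q)) p (X p)
        - localConn hg α (fun q ↦ hom hg q (X q)) p (Y p)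
      = hom hg p (VectorField.mlieBracket (𝓡 2) X Y p) := by
  have h (i : Fin 2) (X : ∀ p : M, TangentSpace (𝓡 2) p) :=
    mvfderiv_congr_of_eventuallyEq (Filter.eventually_of_mem
      (α.chart.open_source.mem_nhds hp) fun q hq ↦ inner_frame_hom (hg := hg) hq i (X q))
  have e0 := mvfderiv_coframe_sub hp 0 hX hY
  have e1 := mvfderiv_coframe_sub hp 1 hX hY
  have h10 : mvfderiv (𝓡 2) (fun q ↦ α.coframeMatrix q 1 0) p = 0 := mvfderiv_const (0 : ℝ)
  have hθ (v : TangentSpace (𝓡 2) p) : α.connectionForm hg p v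
      = (mvfderiv (𝓡 2) α.chart p v : Plane) 0 * α.connectionForm hg p (coordField α.chart 0 p)
        + (mvfderiv (𝓡 2) α.chart p v : Plane) 1
          * α.connectionForm hg p (coordField α.chart 1 p) := by
    conv_lhs => rw [eq_sum_coordField α.mem_maximalAtlas hp v]
    simp [Fin.sum_univ_two]
  have s0 := mul_connectionForm_coordField_zero (hg := hg) hp
  have s1 := mul_connectionForm_coordField_one (hg := hg) hp
  rw [h10] at e1
  simp only [_root_.zero_apply, sub_zero] at e1
  set K := (mvfderiv (𝓡 2) α.chart p (X p) : Plane) 0 * (mvfderiv (𝓡 2) α.chart p (Y p) : Plane) 1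
    - (mvfderiv (𝓡 2) α.chart p (X p) : Plane) 1 * (mvfderiv (𝓡 2) α.chart p (Y p) : Plane) 0
  have c0 : mvfderiv (𝓡 2) (fun q ↦ α.coframe 0 q (Y q)) p (X p)
        + α.coframe 1 p (Y p) * α.connectionForm hg p (X p)
      - (mvfderiv (𝓡 2) (fun q ↦ α.coframe 0 q (X q)) p (Y p)
        + α.coframe 1 p (X p) * α.connectionForm hg p (Y p))
      = α.coframe 0 p (VectorField.mlieBracket (𝓡 2) X Y p) := by
    rw [coframe_apply 1 (Y p), coframe_apply 1 (X p), hθ (X p), hθ (Y p),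
      coframeMatrix_apply_one_zero]
    linear_combination e0 + K * s0
  have c1 : mvfderiv (𝓡 2) (fun q ↦ α.coframe 1 q (Y q)) p (X p)
        - α.coframe 0 p (Y p) * α.connectionForm hg p (X p)
      - (mvfderiv (𝓡 2) (fun q ↦ α.coframe 1 q (X q)) p (Y p)
        - α.coframe 0 p (X p) * α.connectionForm hg p (Y p))
      = α.coframe 1 p (VectorField.mlieBracket (𝓡 2) X Y p) := by
    rw [coframe_apply 0 (Y p), coframe_apply 0 (X p), hθ (X p), hθ (Y p)]
    linear_combination e1 + K * s1
  rw [localConn_apply, localConn_apply, h, h, h, h, hom_eq_sum_coframe hp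
    (VectorField.mlieBracket (𝓡 2) X Y p), Fin.sum_univ_two, ← c0, ← c1]
  simp only [inner_frame_hom hp]
  module

/-- On overlaps, the local connections agree: off the singular set since they are metric and
torsion-free, and on it by continuity. -/
lemma localConn_eq {s : ∀ p : M, FrameFiber hg p} (hα : p ∈ α.chart.source)
    (hβ : p ∈ β.chart.source) (hs : SectionDifferentiableAt s p) :
    localConn hg α s p = localConn hg β s p := by
  -- the connection form of `D^α` with respect to the frame of `β`
  let τ (q : M) (v : TangentSpace (𝓡 2) q) : ℝ :=
    inner ℝ (frame hg β 0 q) (localConn hg α (frame hg β 1) q v)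
  have hframe {q : M} (hqα : q ∈ α.chart.source) (hqβ : q ∈ β.chart.source)
      (v : TangentSpace (𝓡 2) q) :
      localConn hg α (frame hg β 0) q v = -τ q v • frame hg β 1 q ∧
        localConn hg α (frame hg β 1) q v = τ q v • frame hg β 0 q := by
    have h (i j : Fin 2) : inner ℝ (localConn hg α (frame hg β i) q v) (frame hg β j q)
        + inner ℝ (frame hg β i q) (localConn hg α (frame hg β j) q v) = 0 := by
      rw [← mvfderiv_inner_eq hqα (sectionDifferentiableAt_frame hqβ i)
        (sectionDifferentiableAt_frame hqβ j), mvfderiv_congr_of_eventuallyEq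
        (Filter.eventually_of_mem (β.chart.open_source.mem_nhds hqβ)
          fun x hx ↦ inner_frame_self hx i j), mvfderiv_const]
      rfl
    have h00 := h 0 0
    have h11 := h 1 1
    have h01 := h 0 1
    rw [real_inner_comm, ← two_mul] at h00 h11
    rw [real_inner_comm] at h01
    constructor
    · rw [eq_sum_inner_frame hqβ (localConn hg α (frame hg β 0) q v),
        eq_neg_of_add_eq_zero_left h01]
      simp [by simpa using h00, τ]
    · rw [eq_sum_inner_frame hqβ (localConn hg α (frame hg β 1) q v)]
      simp [by simpa using h11, τ]
  have hinner {q : M} (hqα : q ∈ α.chart.source) (hqβ : q ∈ β.chart.source)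
      {s : ∀ p : M, FrameFiber hg p} (hs : SectionDifferentiableAt s q)
      (v : TangentSpace (𝓡 2) q) :
      inner ℝ (frame hg β 0 q) (localConn hg α s q v)
        = mvfderiv (𝓡 2) (fun q ↦ inner ℝ (frame hg β 0 q) (s q)) q v
          + inner ℝ (frame hg β 1 q) (s q) * τ q v ∧
      inner ℝ (frame hg β 1 q) (localConn hg α s q v)
        = mvfderiv (𝓡 2) (fun q ↦ inner ℝ (frame hg β 1 q) (s q)) q v
          - inner ℝ (frame hg β 0 q) (s q) * τ q v := by
    rw [mvfderiv_inner_eq hqα (sectionDifferentiableAt_frame hqβ 0) hs,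
      mvfderiv_inner_eq hqα (sectionDifferentiableAt_frame hqβ 1) hs, (hframe hqα hqβ v).1,
      (hframe hqα hqβ v).2, real_inner_smul_left, real_inner_smul_left]
    constructor <;> ring
  -- `τ` satisfies the structure equations of `β`, since `D^α` is torsion-free
  have hτ {q : M} (hqα : q ∈ α.chart.source) (hqβ : q ∈ β.chart.source) :
      β.coframeMatrix q 1 1 * τ q (coordField β.chart 0 q)
        = β.coframeMatrix q 1 1 * β.connectionForm hg q (coordField β.chart 0 q) ∧
      β.coframeMatrix q 0 0 * τ q (coordField β.chart 1 q)
        = β.coframeMatrix q 0 1 * τ q (coordField β.chart 0 q)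
        - mvfderiv (𝓡 2) (fun q ↦ β.coframeMatrix q 1 1) q (coordField β.chart 0 q) := by
    have hc (i : Fin 2) := contMDiffAt_coordField β.mem_maximalAtlas i hqβ
    have hd (i : Fin 2) : FieldDifferentiableAt (coordField β.chart i) q :=
      (hc i).mdifferentiableAt (by simp)
    have hdh (i : Fin 2) : SectionDifferentiableAt
        (fun q ↦ hom hg q (coordField β.chart i q)) q :=
      (contMDiffAt_hom_apply (hc i)).mdifferentiableAt (by simp)
    have ht := localConn_hom_sub (hg := hg) hqα (hd 0) (hd 1)
    rw [mlieBracket_coordField β.mem_maximalAtlas 0 1 hqβ, map_zero, sub_eq_zero] at ht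
    have hS (i j : Fin 2) := mvfderiv_congr_of_eventuallyEq
        (Filter.eventually_of_mem (β.chart.open_source.mem_nhds hqβ)
          fun x hx ↦ (inner_frame_hom (hg := hg) hx i (coordField β.chart j x)).trans
            (coframe_coordField hx i j))
    have h10 : mvfderiv (𝓡 2) (fun q ↦ β.coframeMatrix q 1 0) q = 0 := mvfderiv_const (0 : ℝ)
    have t0 := congrArg (inner ℝ (frame hg β 0 q)) ht
    have t1 := congrArg (inner ℝ (frame hg β 1 q)) ht
    rw [(hinner hqα hqβ (hdh _) _).1, (hinner hqα hqβ (hdh _) _).1, hS, hS] at t0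
    rw [(hinner hqα hqβ (hdh _) _).2, (hinner hqα hqβ (hdh _) _).2, hS, hS, h10] at t1
    simp only [inner_frame_hom hqβ, coframe_coordField hqβ, coframeMatrix_apply_one_zero,
      _root_.zero_apply] at t0 t1
    have s0 := mul_connectionForm_coordField_zero (hg := hg) hqβ
    constructor
    · linear_combination t0 - s0
    · linear_combination t1
  have hu : τ p (coordField β.chart 0 p) = β.connectionForm hg p (coordField β.chart 0 p) := by
    have hc := contMDiffAt_coordField β.mem_maximalAtlas 0 hβ
    refine eq_of_eventually_mul_eq_mul (f := fun q ↦ τ q (coordField β.chart 0 q))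
      (k := fun q ↦ β.connectionForm hg q (coordField β.chart 0 q))
      (mvfderiv_lam_ne_zero hg hβ)
      ((contMDiffAt_frame hβ 0).inner_bundle
        (contMDiffAt_localConn_apply hα (contMDiffAt_frame hβ 1) hc)).continuousAt
      (contMDiffAt_connectionForm_apply hβ hc).continuousAt ?_
    filter_upwards [α.chart.open_source.mem_nhds hα, β.chart.open_source.mem_nhds hβ] with q h1 h2
    rw [lam_eq h2, mul_assoc, (hτ h1 h2).1, mul_assoc]
  have hv : τ p (coordField β.chart 1 p) = β.connectionForm hg p (coordField β.chart 1 p) := by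
    refine mul_left_cancel₀ (coframeMatrix_apply_zero_zero_pos hβ).ne' ?_
    rw [(hτ hα hβ).2, hu, mul_connectionForm_coordField_one hβ]
  have hθ (v : TangentSpace (𝓡 2) p) : τ p v = β.connectionForm hg p v := by
    rw [eq_sum_coordField β.mem_maximalAtlas hβ v]
    simp only [Fin.sum_univ_two, map_add, map_smul, τ, inner_add_right, inner_smul_right] at hu hv ⊢
    rw [hu, hv]
    rfl
  ext v
  rw [eq_sum_inner_frame hβ (localConn hg α s p v), (hinner hα hβ hs v).1,
    (hinner hα hβ hs v).2, hθ, localConn_apply]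

variable (hg) in
/-- The connection of the glued bundle, defined at `p` by the local connection of the frame chart
that the bundle assigns to `p`. -/
def conn : CovariantDerivative (𝓡 2) Plane (FrameFiber hg) where
  toFun s p := localConn hg ((frameCore hg).indexAt p) s p
  isCovariantDerivativeOnUniv :=
    { add := fun {_ _ p} hs ht _ ↦
        isCovariantDerivativeOn_localConn.add hs ht ((frameCore hg).mem_baseSet_at p)
      leibniz := fun {_ _ p} hs hf _ ↦
        isCovariantDerivativeOn_localConn.leibniz hs hf ((frameCore hg).mem_baseSet_at p) }

lemma conn_eq_localConn {s : ∀ p : M, FrameFiber hg p} (hp : p ∈ α.chart.source)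
    (hs : SectionDifferentiableAt s p) : conn hg s p = localConn hg α s p :=
  localConn_eq ((frameCore hg).mem_baseSet_at p) hp hs

lemma conn_frame_zero (hp : p ∈ α.chart.source) (v : TangentSpace (𝓡 2) p) :
    conn hg (frame hg α 0) p v = -α.connectionForm hg p v • frame hg α 1 p := by
  rw [conn_eq_localConn hp (sectionDifferentiableAt_frame hp 0), localConn_frame_zero hp]

lemma conn_frame_one (hp : p ∈ α.chart.source) (v : TangentSpace (𝓡 2) p) :
    conn hg (frame hg α 1) p v = α.connectionForm hg p v • frame hg α 0 p := by
  rw [conn_eq_localConn hp (sectionDifferentiableAt_frame hp 1), localConn_frame_one hp]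

lemma contMDiffCovariantDerivative_conn : (conn hg).ContMDiffCovariantDerivative ∞ where
  contMDiff := ⟨fun {s} hs ↦ by
    have hs' (p : M) : ContMDiffAt (𝓡 2) ((𝓡 2).prod 𝓘(ℝ, Plane)) ∞
        (fun q ↦ TotalSpace.mk' Plane q (s q)) p :=
      (hs.contMDiffAt Filter.univ_mem).of_le (by simp)
    intro p _
    obtain ⟨α, hp⟩ := hg.exists_frameChart p
    refine (contMDiffAt_hom_of_apply fun X hX ↦ ?_).contMDiffWithinAt
    refine (contMDiffAt_localConn_apply (α := α) hp (hs' p) hX).congr_of_eventuallyEq ?_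
    filter_upwards [α.chart.open_source.mem_nhds hp] with q hq
    rw [conn_eq_localConn hq ((hs' q).mdifferentiableAt (by simp))]⟩

lemma isMetricCompatible_conn : (conn hg).IsMetricCompatible := by
  rw [CovariantDerivative.isMetricCompatible_iff]
  intro p X s t _ hs ht
  exact mvfderiv_inner_eq ((frameCore hg).mem_baseSet_at p) hs ht (X p)

lemma conn_hom_sub {X Y : ∀ p : M, TangentSpace (𝓡 2) p}
    (hX : FieldDifferentiableAt X p) (hY : FieldDifferentiableAt Y p) :
    conn hg (fun q ↦ hom hg q (Y q)) p (X p) - conn hg (fun q ↦ hom hg q (X q)) p (Y p)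
      = hom hg p (VectorField.mlieBracket (𝓡 2) X Y p) :=
  localConn_hom_sub ((frameCore hg).mem_baseSet_at p) hX hY

variable (hg) in
/-- The coherent tangent bundle glued from the orthonormal frames of a Kossowski metric. -/
def coherentTangentBundle : CoherentTangentBundle M where
  fiber := FrameFiber hg
  conn := conn hg
  contMDiff_conn := contMDiffCovariantDerivative_conn
  isMetric_conn := isMetricCompatible_conn
  hom := hom hg
  contMDiff_hom := contMDiff_hom
  coherent X Y hX hY p := conn_hom_sub ((hX p).mdifferentiableAt (by simp))
    ((hY p).mdifferentiableAt (by simp))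

end SemiMetric.FrameFiber

/-! ### The Levi-Civita connection off the singular set -/

namespace SemiMetric.FrameFiber

open FrameChart

variable {M : Type*} [TopologicalSpace M] [ChartedSpace Plane M]
  [IsManifold (𝓡 2) ∞ M] {g : SemiMetric M} {hg : g.IsKossowski} {α β : g.FrameChart} {p : M}

lemma lam_ne_zero (hp : p ∈ α.chart.source) (h : p ∉ g.singularSet) : α.lam p ≠ 0 :=
  fun h0 ↦ h ((isSingular_iff hp).2 h0)

lemma hom_tangentFrame (hp : p ∈ α.chart.source) (h : p ∉ g.singularSet) (i : Fin 2) :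
    hom hg p (α.tangentFrame i p) = frame hg α i p := by
  rw [hom_eq_sum_coframe hp, Fin.sum_univ_two, coframe_tangentFrame hp (lam_ne_zero hp h),
    coframe_tangentFrame hp (lam_ne_zero hp h)]
  fin_cases i <;> simp

lemma hom_injective (h : p ∉ g.singularSet) : Function.Injective (hom hg p) := by
  refine (injective_iff_map_eq_zero _).2 fun v hv ↦ ?_
  by_contra hv0
  have h1 : 0 < g.form p v v := not_not.1 h v hv0
  rw [← inner_hom_hom (hg := hg), hv, inner_zero_left] at h1
  exact h1.false

lemma sectionDifferentiableAt_hom {X : ∀ p : M, TangentSpace (𝓡 2) p}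
    (hX : FieldDifferentiableAt X p) : SectionDifferentiableAt (fun q ↦ hom hg q (X q)) p :=
  ((contMDiff_hom (hg := hg) p).mdifferentiableAt (by simp)).clm_bundle_apply hX

variable [T2Space M]

variable (hg) in
/-- The Levi-Civita connection off the singular set: the pull-back `ψ⁻¹ ∘ D ∘ ψ`, where `ψ⁻¹` maps
the frame of the glued bundle to the orthonormal frame of the tangent bundle. The values at singular
points have no meaning. -/
def nabla (Y : ∀ p : M, TangentSpace (𝓡 2) p) (p : M) :
    TangentSpace (𝓡 2) p →L[ℝ] TangentSpace (𝓡 2) p :=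
  ∑ i, ((innerSL ℝ (frame hg ((frameCore hg).indexAt p) i p)).comp
    (conn hg (fun q ↦ hom hg q (Y q)) p)).smulRight (((frameCore hg).indexAt p).tangentFrame i p)

lemma hom_nabla (h : p ∉ g.singularSet) (Y : ∀ p : M, TangentSpace (𝓡 2) p)
    (v : TangentSpace (𝓡 2) p) :
    hom hg p (nabla hg Y p v) = conn hg (fun q ↦ hom hg q (Y q)) p v := by
  have hι := (frameCore hg).mem_baseSet_at p
  conv_rhs => rw [eq_sum_inner_frame hι (conn hg (fun q ↦ hom hg q (Y q)) p v)]
  simp only [nabla, Fin.sum_univ_two, _root_.add_apply, map_add,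
    ContinuousLinearMap.smulRight_apply, map_smul, hom_tangentFrame hι h]
  rfl

lemma isLeviCivitaOn_nabla : g.IsLeviCivitaOn (nabla hg) g.singularSetᶜ where
  isCovariantDerivativeOn := by
    refine ⟨fun {Y Z p} hY hZ hp ↦ ?_, fun {Y f p} hY hf hp ↦ ?_⟩
    · ext1 v
      refine hom_injective (hg := hg) hp ?_
      have h : (fun q ↦ hom hg q ((Y + Z) q))
          = (fun q ↦ hom hg q (Y q)) + fun q ↦ hom hg q (Z q) := by
        funext q; simp
      rw [hom_nabla hp, h, (conn hg).isCovariantDerivativeOnUniv.add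
        (sectionDifferentiableAt_hom hY) (sectionDifferentiableAt_hom hZ)]
      simp [hom_nabla hp]
    · ext1 v
      refine hom_injective (hg := hg) hp ?_
      have h : (fun q ↦ hom hg q ((f • Y) q)) = f • fun q ↦ hom hg q (Y q) := by
        funext q; simp
      rw [hom_nabla hp, h, (conn hg).isCovariantDerivativeOnUniv.leibniz
        (sectionDifferentiableAt_hom hY) hf]
      simp [hom_nabla hp]
  metric {Y Z p} hp hY hZ v := by
    simp only [← inner_hom_hom (hg := hg), hom_nabla hp]
    exact mvfderiv_inner_eq ((frameCore hg).mem_baseSet_at p) (sectionDifferentiableAt_hom hY)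
      (sectionDifferentiableAt_hom hZ) v
  torsion_free {X Y p} hp hX hY := by
    refine hom_injective (hg := hg) hp ?_
    rw [map_sub, hom_nabla hp, hom_nabla hp, conn_hom_sub hX hY]

lemma connectionForm_eq (hp : p ∈ α.chart.source) (h : p ∉ g.singularSet)
    (v : TangentSpace (𝓡 2) p) :
    α.connectionForm hg p v
      = -g.form p (nabla hg (α.tangentFrame 0) p v) (α.tangentFrame 1 p) := by
  have he : ∀ᶠ q in 𝓝 p, hom hg q (α.tangentFrame 0 q) = frame hg α 0 q := by
    filter_upwards [α.chart.open_source.mem_nhds hp,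
      (contMDiffAt_lam hp).continuousAt.eventually_ne (lam_ne_zero hp h)] with q hq hl
    exact hom_tangentFrame hq (fun h0 ↦ hl ((isSingular_iff hq).1 h0)) 0
  have hd : SectionDifferentiableAt (fun q ↦ hom hg q (α.tangentFrame 0 q)) p :=
    (sectionDifferentiableAt_frame hp 0).congr_of_eventuallyEq
      (he.mono fun q hq ↦ by simp only [hq])
  rw [← inner_hom_hom (hg := hg), hom_nabla h, hom_tangentFrame hp h,
    (conn hg).isCovariantDerivativeOnUniv.congr_of_eventuallyEq hd
      (sectionDifferentiableAt_frame hp 0) Filter.univ_mem he,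
    conn_frame_zero hp, real_inner_smul_left, inner_frame_self hp]
  simp

lemma isGluedFromFrames : (coherentTangentBundle hg).IsGluedFromFrames g (frame hg)
    FrameChart.trans (nabla hg) (fun α ↦ α.connectionForm hg) where
  cover := hg.exists_frameChart
  contMDiffOn_frame _ i _ hp := (contMDiffAt_frame hp i).contMDiffWithinAt
  orthonormal_frame _ _ hp := orthonormal_frame hp
  hom_tangentFrame _ _ hp h i := hom_tangentFrame hp h i
  contMDiffOn_trans _ _ i j _ hp := (contMDiffAt_trans hg hp.1 hp.2 i j).contMDiffWithinAt
  trans_mem _ _ _ hp := trans_mem_orthogonalGroup hp.1 hp.2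
  trans_eq _ _ _ hp h := trans_eq_inv_mul hg hp.1 hp.2 h
  frame_eq _ _ _ hp j := frame_eq_sum_trans hp.1 hp.2 j
  isLeviCivitaOn := isLeviCivitaOn_nabla
  hom_nabla Y _ hp _ v := hom_nabla hp Y v
  contMDiffOn_form _ _ hp := (contMDiffAt_connectionForm hp).contMDiffWithinAt
  form_eq _ _ hp h v := connectionForm_eq hp h v
  conn_frame_zero _ _ hp v := conn_frame_zero hp v
  conn_frame_one _ _ hp v := conn_frame_one hp v

end SemiMetric.FrameFiber

/-! ### Orientation -/

namespace SemiMetric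

open FrameChart FrameFiber

variable {M : Type*} [TopologicalSpace M] [ChartedSpace Plane M] [IsManifold (𝓡 2) ∞ M]
  {g : SemiMetric M} {hg : g.IsKossowski} {α β : g.FrameChart} {p : M}

/-- The data of a co-orientation: a smooth alternating form `dA` whose coefficient in every local
coordinate system is a square root of `E G - F²`. -/
structure IsSignedArea (g : SemiMetric M)
    (dA : ∀ p : M, TangentSpace (𝓡 2) p →L[ℝ] TangentSpace (𝓡 2) p →L[ℝ] ℝ) : Prop where
  contMDiff : ContMDiff (𝓡 2) ((𝓡 2).prod 𝓘(ℝ, Plane →L[ℝ] Plane →L[ℝ] ℝ)) ∞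
      (fun p ↦ TotalSpace.mk' (Plane →L[ℝ] Plane →L[ℝ] ℝ) p (dA p))
  self_eq_zero (p : M) (v : TangentSpace (𝓡 2) p) : dA p v v = 0
  sq_eq : ∀ e ∈ IsManifold.maximalAtlas (𝓡 2) ∞ M, ∀ p ∈ e.source,
      g.coeffE e p * g.coeffG e p - g.coeffF e p ^ 2
        = dA p (coordField e 0 p) (coordField e 1 p) ^ 2

variable {dA : ∀ p : M, TangentSpace (𝓡 2) p →L[ℝ] TangentSpace (𝓡 2) p →L[ℝ] ℝ}

variable (dA α) in
/-- The sign `σ = ±1` with `dA = σ η₀ ∧ η₁` near `p`. -/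
def FrameChart.orientSign (p : M) : ℝ :=
  localSign (fun q ↦ dA q (coordField α.chart 0 q) (coordField α.chart 1 q)) α.lam p

lemma IsSignedArea.contMDiffAt_apply (hA : g.IsSignedArea dA) {X Y : ∀ p : M, TangentSpace (𝓡 2) p}
    (hX : ContMDiffAt (𝓡 2) ((𝓡 2).prod (𝓡 2)) ∞ (fun q ↦ TotalSpace.mk' Plane q (X q)) p)
    (hY : ContMDiffAt (𝓡 2) ((𝓡 2).prod (𝓡 2)) ∞ (fun q ↦ TotalSpace.mk' Plane q (Y q)) p) :
    ContMDiffAt (𝓡 2) 𝓘(ℝ) ∞ (fun q ↦ dA q (X q) (Y q)) p := by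
  have h := ContMDiffAt.clm_bundle_apply₂ (F₁ := Plane) (F₂ := Plane) (F₃ := ℝ)
    (E₃ := Bundle.Trivial M ℝ) (hA.contMDiff p) hX hY
  rw [contMDiffAt_section] at h
  exact h

lemma IsSignedArea.eventually_eq (hA : g.IsSignedArea dA) (hg : g.IsKossowski)
    (hp : p ∈ α.chart.source) :
    ∀ᶠ q in 𝓝 p, ∀ v w, dA q v w = α.orientSign dA p * α.area q v w := by
  have h : ∀ᶠ q in 𝓝 p, dA q (coordField α.chart 0 q) (coordField α.chart 1 q)
      = α.orientSign dA p * α.lam q := by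
    refine eventually_eq_localSign_mul (hA.contMDiffAt_apply
      (contMDiffAt_coordField α.mem_maximalAtlas 0 hp)
      (contMDiffAt_coordField α.mem_maximalAtlas 1 hp)) (contMDiffAt_lam hp)
      (mvfderiv_lam_ne_zero hg hp) ?_
    filter_upwards [α.chart.open_source.mem_nhds hp] with q hq
    rw [← hA.sq_eq _ α.mem_maximalAtlas q hq, α.isAreaDensityOn.2 q hq]
  filter_upwards [h, α.chart.open_source.mem_nhds hp] with q h1 hq v w
  have hanti : dA q (coordField α.chart 1 q) (coordField α.chart 0 q)
      = -dA q (coordField α.chart 0 q) (coordField α.chart 1 q) := by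
    have := hA.self_eq_zero q (coordField α.chart 0 q + coordField α.chart 1 q)
    simp only [map_add, _root_.add_apply, hA.self_eq_zero] at this
    linarith
  rw [area_eq_lam_mul hq]
  conv_lhs => rw [eq_sum_coordField α.mem_maximalAtlas hq v,
    eq_sum_coordField α.mem_maximalAtlas hq w]
  simp only [Fin.sum_univ_two, map_add, map_smul, _root_.add_apply, _root_.smul_apply,
    hA.self_eq_zero, hanti, h1, smul_eq_mul]
  ring

lemma IsSignedArea.eventually_orientSign_eq (hA : g.IsSignedArea dA) (hg : g.IsKossowski)
    (hp : p ∈ α.chart.source) : ∀ᶠ q in 𝓝 p, α.orientSign dA q = α.orientSign dA p := by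
  refine eventually_localSign_eq α.chart.open_source hp
    (fun q hq ↦ (hA.contMDiffAt_apply (contMDiffAt_coordField α.mem_maximalAtlas 0 hq)
      (contMDiffAt_coordField α.mem_maximalAtlas 1 hq)).contMDiffWithinAt)
    (fun q hq ↦ (contMDiffAt_lam hq).contMDiffWithinAt)
    (fun q hq ↦ mvfderiv_lam_ne_zero hg hq) fun q hq ↦ ?_
  rw [← hA.sq_eq _ α.mem_maximalAtlas q hq, α.isAreaDensityOn.2 q hq]

lemma IsSignedArea.orientSign_mul_transSign (hA : g.IsSignedArea dA) (hg : g.IsKossowski)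
    (hα : p ∈ α.chart.source) (hβ : p ∈ β.chart.source) :
    α.orientSign dA p * α.transSign β p = β.orientSign dA p := by
  refine eq_of_eventually_eq_mul (p := p)
    (f := fun q ↦ dA q (coordField β.chart 0 q) (coordField β.chart 1 q))
    (mvfderiv_lam_ne_zero hg hβ) ?_ ?_
  · filter_upwards [hA.eventually_eq hg hα, eventually_area_eq hg hα hβ] with q h1 h2
    rw [h1, h2, mul_assoc]
  · filter_upwards [hA.eventually_eq hg hβ, β.chart.open_source.mem_nhds hβ] with q h1 hq
    rw [h1, area_coordField_self hq]

variable (hg dA) in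
/-- The area form of the glued bundle with the orientation given by `dA`: it takes the value
`orientSign` on the frame of a frame chart. -/
def bundleArea (p : M) : FrameFiber hg p →L[ℝ] FrameFiber hg p →L[ℝ] ℝ :=
  letI α := (frameCore hg).indexAt p
  α.orientSign dA p • ((innerSL ℝ (frame hg α 0 p)).smulRight (innerSL ℝ (frame hg α 1 p))
    - (innerSL ℝ (frame hg α 1 p)).smulRight (innerSL ℝ (frame hg α 0 p)))

lemma IsSignedArea.bundleArea_apply (hA : g.IsSignedArea dA) (hp : p ∈ α.chart.source)
    (x y : FrameFiber hg p) : bundleArea hg dA p x y = α.orientSign dA p *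
      (inner ℝ (frame hg α 0 p) x * inner ℝ (frame hg α 1 p) y
        - inner ℝ (frame hg α 1 p) x * inner ℝ (frame hg α 0 p) y) := by
  have hι := (frameCore hg).mem_baseSet_at p
  have hT := trans_sq_add_sq hp hι
  have hs : α.transSign ((frameCore hg).indexAt p) p ^ 2 = 1 := localSign_sq
  simp only [bundleArea, _root_.smul_apply, _root_.sub_apply, ContinuousLinearMap.smulRight_apply,
    innerSL_apply_apply, smul_eq_mul, frame_eq_sum_trans hp hι, Fin.sum_univ_two, inner_add_left,
    real_inner_smul_left, trans_apply_zero_one, trans_apply_one_one,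
    ← hA.orientSign_mul_transSign hg hp hι]
  linear_combination (α.orientSign dA p *
    (inner ℝ (frame hg α 0 p) x * inner ℝ (frame hg α 1 p) y
        - inner ℝ (frame hg α 1 p) x * inner ℝ (frame hg α 0 p) y)) * hs +
    (α.orientSign dA p * α.transSign ((frameCore hg).indexAt p) p ^ 2 *
    (inner ℝ (frame hg α 0 p) x * inner ℝ (frame hg α 1 p) y
        - inner ℝ (frame hg α 1 p) x * inner ℝ (frame hg α 0 p) y)) * hT

lemma IsSignedArea.contMDiff_bundleArea (hA : g.IsSignedArea dA) :
    ContMDiff (𝓡 2) ((𝓡 2).prod 𝓘(ℝ, Plane →L[ℝ] Plane →L[ℝ] ℝ)) ∞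
      (fun p ↦ TotalSpace.mk' (Plane →L[ℝ] Plane →L[ℝ] ℝ)
        (E := fun p ↦ FrameFiber hg p →L[ℝ] FrameFiber hg p →L[ℝ] ℝ) p (bundleArea hg dA p)) := by
  intro p
  refine contMDiffAt_hom_of_apply (V₁ := FrameFiber hg) (V₂ := fun p ↦ FrameFiber hg p →L[ℝ] ℝ)
    fun s hs ↦ contMDiffAt_hom_of_apply (V₁ := FrameFiber hg) (V₂ := Bundle.Trivial M ℝ)
    fun t ht ↦ ?_
  rw [contMDiffAt_section]
  obtain ⟨α, hp⟩ := hg.exists_frameChart p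
  have h (i : Fin 2) {s : ∀ p : M, FrameFiber hg p}
      (hs : ContMDiffAt (𝓡 2) ((𝓡 2).prod 𝓘(ℝ, Plane)) ∞
        (fun q ↦ TotalSpace.mk' Plane q (s q)) p) :
      ContMDiffAt (𝓡 2) 𝓘(ℝ) ∞ (fun q ↦ inner ℝ (frame hg α i q) (s q)) p :=
    (contMDiffAt_frame hp i).inner_bundle hs
  refine ((contMDiffAt_const (c := α.orientSign dA p)).mul
    (((h 0 hs).mul (h 1 ht)).sub ((h 1 hs).mul (h 0 ht)))).congr_of_eventuallyEq ?_
  filter_upwards [hA.eventually_orientSign_eq hg hp, α.chart.open_source.mem_nhds hp] with q h1 hq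
  exact (hA.bundleArea_apply hq (s q) (t q)).trans (by rw [h1]; rfl)

lemma IsSignedArea.bundleArea_eq_one_or (hA : g.IsSignedArea dA) {b : Fin 2 → FrameFiber hg p}
    (hb : Orthonormal ℝ b) :
    bundleArea hg dA p (b 0) (b 1) = 1 ∨ bundleArea hg dA p (b 0) (b 1) = -1 := by
  obtain ⟨α, hp⟩ := hg.exists_frameChart p
  have e (i j : Fin 2) := (inner_eq_sum_frame hp (b i) (b j)).symm.trans
    (orthonormal_iff_ite.1 hb i j)
  have e00 := e 0 0
  have e01 := e 0 1
  have e11 := e 1 1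
  simp only [if_true, zero_ne_one, if_false] at e00 e01 e11
  have hs : α.orientSign dA p ^ 2 = 1 := localSign_sq
  refine mul_self_eq_one_iff.1 ?_
  rw [hA.bundleArea_apply hp]
  -- the square of the determinant is the Gram determinant
  set x₀ := inner ℝ (frame hg α 0 p) (b 0)
  set x₁ := inner ℝ (frame hg α 1 p) (b 0)
  set y₀ := inner ℝ (frame hg α 0 p) (b 1)
  set y₁ := inner ℝ (frame hg α 1 p) (b 1)
  linear_combination (x₀ * y₁ - x₁ * y₀) ^ 2 * hs + (y₀ * y₀ + y₁ * y₁) * e00 + e11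
    - (x₀ * y₀ + x₁ * y₁) * e01

lemma isOrientable_of_isCoorientable [T2Space M] (h : g.IsCoorientable) :
    (coherentTangentBundle hg).IsOrientable := by
  obtain ⟨dA, h1, h2, h3⟩ := h
  have hA : g.IsSignedArea dA := ⟨h1, h2, h3⟩
  refine ⟨bundleArea hg dA, hA.contMDiff_bundleArea, fun p (v : FrameFiber hg p) ↦ ?_,
    fun p b hb ↦ hA.bundleArea_eq_one_or hb⟩
  obtain ⟨α, hp⟩ := hg.exists_frameChart p
  exact (hA.bundleArea_apply hp v v).trans (by ring)

end SemiMetric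

theorem mainTheorem1 {M : Type*} [TopologicalSpace M] [T2Space M] [ChartedSpace Plane M]
    [IsManifold (𝓡 2) ∞ M] (g : SemiMetric M) (hg : g.IsKossowski) :
    ∃ 𝓔 : CoherentTangentBundle M,
      𝓔.IsFirstFundamentalForm g ∧
      (∃ frame trans nabla θ, 𝓔.IsGluedFromFrames g frame trans nabla θ) ∧
      (g.IsCoorientable → 𝓔.IsOrientable) :=
  ⟨SemiMetric.FrameFiber.coherentTangentBundle hg,
    fun _ v w ↦ (SemiMetric.FrameFiber.inner_hom_hom (hg := hg) v w).symm,
    ⟨_, _, _, _, SemiMetric.FrameFiber.isGluedFromFrames⟩,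
    SemiMetric.isOrientable_of_isCoorientable⟩

end
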